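/- Let $\mathbb D=\{z\in\mathbb C:|z|<1\}$, let $\mathbb T=\partial\mathbb D$, and let $\alpha\in\mathbb R$ with $\alpha>-1$. Let $f\in\mathcal C^2(\mathbb D)$ be a complex-valued $\alpha$-harmonic function, that is, $$\Delta_\alpha f:=\partial_z\bigl((1-|z|^2)^{-\alpha}\,\partial_{\bar z}f\bigr)=0\quad\text{in }\mathbb D,$$ where $\partial_z=\tfrac12(\partial_x-i\partial_y)$ and $\partial_{\bar z}=\tfrac12(\partial_x+i\partial_y)$. Suppose that $f$ has boundary values $f^*$, where $f^*:\mathbb T\to\mathbb C$ is continuous, in the sense that $f(re^{i\theta})\to f^*(e^{i\theta})$ in the space of distributions $\mathcal D'(\mathbb T)$ as $r\to1^-$; that is, for every smooth $2\pi$-periodic $\varphi:\mathbb R\to\mathbb C$, $$\lim_{r\to1^-}\int_0^{2\pi}f(re^{i\theta})\varphi(\theta)\,d\theta=\int_0^{2\pi}f^*(e^{i\theta})\varphi(\theta)\,d\theta .$$ Write $\|D_f(z)\|=|f_z(z)|+|f_{\bar z}(z)|$ with $f_z=\partial_zf$ and $f_{\bar z}=\partial_{\bar z}f$, $\|f^*\|_\infty=\sup_{\zeta\in\mathbb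 T}|f^*(\zeta)|$, and ${}_2F_1(a,b;c;x)=\sum_{n\ge0}\frac{(a)_n(b)_n}{(c)_n\,n!}x^n$ for $|x|<1$, where $(a)_0=1$ and $(a)_n=a(a+1)\cdots(a+n-1)$ for $n\ge1$. Then for every $z\in\mathbb D$, $$\|D_f(z)\|\le\begin{cases}\dfrac{2(1+\alpha)\|f^*\|_\infty}{1-|z|^2}\;{}_2F_1\!\left(-\dfrac{\alpha}{2},-\dfrac{\alpha}{2};1;|z|^2\right), & \alpha\ge0,\\[3mm] \dfrac{2\|f^*\|_\infty}{1-|z|^2}\;{}_2F_1\!\left(-\dfrac{\alpha}{2},-\dfrac{\alpha}{2};1;|z|^2\right), & -1<\alpha<0.\end{cases}$$ -/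

import Mathlib

open scoped ContDiff

/-- The Wirtinger derivative `∂f/∂z = (∂f/∂x - i ∂f/∂y) / 2`. -/
noncomputable def wirtingerZ (f : ℂ → ℂ) (z : ℂ) : ℂ :=
  (1 / 2) * (fderiv ℝ f z 1 - Complex.I * fderiv ℝ f z Complex.I)

/-- The Wirtinger derivative `∂f/∂z̄ = (∂f/∂x + i ∂f/∂y) / 2`. -/
noncomputable def wirtingerZBar (f : ℂ → ℂ) (z : ℂ) : ℂ :=
  (1 / 2) * (fderiv ℝ f z 1 + Complex.I * fderiv ℝ f z Complex.I)

/-- The weighted Laplace operator `Δ_α = ∂_z (1 - |z|²)^(-α) ∂_z̄`. -/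
noncomputable def weightedLaplacian (α : ℝ) (f : ℂ → ℂ) (z : ℂ) : ℂ :=
  wirtingerZ (fun w : ℂ => (((1 - ‖w‖ ^ 2) ^ (-α) : ℝ) : ℂ) * wirtingerZBar f w) z

/-- `f` is `α`-harmonic in the open unit disk: it is of class `C²` there (in the real sense) and
`Δ_α f = 0` there. The values of `f` off the open disk play no role. -/
structure IsAlphaHarmonic (α : ℝ) (f : ℂ → ℂ) : Prop where
  contDiffOn : ContDiffOn ℝ 2 f (Metric.ball (0 : ℂ) 1)
  weightedLaplacian_eq_zero : ∀ z ∈ Metric.ball (0 : ℂ) 1, weightedLaplacian α f z = 0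

/-- `f(r e^{iθ}) → g(e^{iθ})` as `r → 1⁻` in the space of distributions on the unit circle.
Test functions on the circle are smooth `2π`-periodic functions of `θ`. -/
def HasDistributionalBoundaryValue (f : ℂ → ℂ) (g : Circle → ℂ) : Prop :=
  ∀ φ : ℝ → ℂ, ContDiff ℝ ∞ φ → Function.Periodic φ (2 * Real.pi) →
    Filter.Tendsto
      (fun r : ℝ => ∫ θ in (0 : ℝ)..(2 * Real.pi), f ((r : ℂ) * (Circle.exp θ : ℂ)) * φ θ)
      (nhdsWithin 1 (Set.Iio 1))
      (nhds (∫ θ in (0 : ℝ)..(2 * Real.pi), g (Circle.exp θ) * φ θ))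

/-- The norm `‖D_f(z)‖ = |f_z(z)| + |f_z̄(z)|` of the formal differential. -/
noncomputable def normD (f : ℂ → ℂ) (z : ℂ) : ℝ :=
  ‖wirtingerZ f z‖ + ‖wirtingerZBar f z‖

/-!
Put `K(z) = (1 - |z|²)^(α+1) / ((1 - z) (1 - z̄)^(α+1))`. The proof represents `f` as the Poisson
integral `f(z) = (2π)⁻¹ ∫ K(z e^{-iφ}) f*(e^{iφ}) dφ` and differentiates under the integral sign.

*Representation* (`IsAlphaHarmonic.eq_alphaPoisson`). The equation `Δ_α f = 0` says that
`(1 - |z|²)^(-α) ∂_z̄ f` is antiholomorphic. In polar coordinates this is a linear equation for each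
Fourier coefficient of `θ ↦ f(r e^{iθ})` as a function of `r`, and regularity at the origin leaves a
space of solutions of dimension at most one (`IsAlphaHarmonic.exists_circleCoeff_eq_mul`). The
kernel `K` is itself `α`-harmonic, and it is an approximate identity because `α + 1 > 0`, so each of
its coefficients has a nonzero limit as `r → 1` (`tendsto_circleCoeff_alphaKernel`). Hence the
coefficients of `f` are multiples of those of `K`, and the distributional boundary value determines
the factor. On every circle `f` and the Poisson integral then have the same Fourier coefficients,
so they agree.

*Estimate* (`normD_alphaPoisson_le`). Direct computation gives `|∂_z̄ K| = (1+α) |K| / (1-|z|²)` and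
`|∂_z K| ≤ (1+|α|) |K| / (1-|z|²)`. The sum of the two constants is `2 (1 + α)` for `α ≥ 0` and `2`
for `α < 0`. What remains is the mean of `|K|` over a circle, which equals the hypergeometric
function of the statement (`integral_norm_alphaKernel`). A Möbius change of variables on the
circle, which amounts to Euler's transformation of `₂F₁`, turns this mean into that of
`|1 + r e^{iφ}|^α = |(1 + r e^{iφ})^(α/2)|²`, and Parseval's identity for the binomial series
evaluates it.
-/

open scoped ComplexConjugate

/-! ### Wirtinger calculus -/

/-- The real-linear map `v ↦ a v + b v̄`; a function whose real derivative is this map has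
Wirtinger derivatives `a` and `b`. -/
noncomputable def wirtingerCLM (a b : ℂ) : ℂ →L[ℝ] ℂ :=
  a • ContinuousLinearMap.id ℝ ℂ + b • (Complex.conjCLE : ℂ →L[ℝ] ℂ)

theorem wirtingerCLM_apply (a b v : ℂ) : wirtingerCLM a b v = a * v + b * conj v := by
  simp [wirtingerCLM]

theorem wirtingerZ_eq_of_hasFDerivAt {f : ℂ → ℂ} {a b z : ℂ}
    (h : HasFDerivAt f (wirtingerCLM a b) z) : wirtingerZ f z = a := by
  rw [wirtingerZ, h.fderiv, wirtingerCLM_apply, wirtingerCLM_apply]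
  simp only [map_one, Complex.conj_I]
  linear_combination (-(a - b) / 2) * Complex.I_sq

theorem wirtingerZBar_eq_of_hasFDerivAt {f : ℂ → ℂ} {a b z : ℂ}
    (h : HasFDerivAt f (wirtingerCLM a b) z) : wirtingerZBar f z = b := by
  rw [wirtingerZBar, h.fderiv, wirtingerCLM_apply, wirtingerCLM_apply]
  simp only [map_one, Complex.conj_I]
  linear_combination ((a - b) / 2) * Complex.I_sq

theorem fderiv_eq_wirtingerCLM (f : ℂ → ℂ) (z : ℂ) :
    fderiv ℝ f z = wirtingerCLM (wirtingerZ f z) (wirtingerZBar f z) := by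
  ext v
  have hv : v = v.re • (1 : ℂ) + v.im • Complex.I := by
    simp [Complex.re_add_im]
  have h1 : conj v = v.re - v.im * Complex.I := by
    apply Complex.ext <;> simp
  rw [wirtingerCLM_apply, h1]
  conv_lhs => rw [hv, map_add, map_smul, map_smul]
  conv_rhs => rw [← Complex.re_add_im v]
  simp only [wirtingerZ, wirtingerZBar, Complex.real_smul, Complex.add_re, Complex.add_im,
    Complex.mul_re, Complex.mul_im, Complex.ofReal_re, Complex.ofReal_im, Complex.I_re,
    Complex.I_im]
  simp only [mul_zero, mul_one, sub_zero, add_zero, zero_add]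
  linear_combination (v.im * fderiv ℝ f z Complex.I) * Complex.I_sq

theorem HasFDerivAt.wirtinger_mul {f g : ℂ → ℂ} {a b c d z : ℂ}
    (hf : HasFDerivAt f (wirtingerCLM a b) z) (hg : HasFDerivAt g (wirtingerCLM c d) z) :
    HasFDerivAt (fun w => f w * g w)
      (wirtingerCLM (a * g z + f z * c) (b * g z + f z * d)) z := by
  refine (hf.mul hg).congr_fderiv ?_
  ext v
  simp [wirtingerCLM_apply]
  ring

/-- The chain rule with a holomorphic outer function. -/
theorem HasDerivAt.wirtinger_comp {φ u : ℂ → ℂ} {φ' a b z : ℂ} (hφ : HasDerivAt φ φ' (u z))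
    (hu : HasFDerivAt u (wirtingerCLM a b) z) :
    HasFDerivAt (fun w => φ (u w)) (wirtingerCLM (φ' * a) (φ' * b)) z := by
  refine ((hφ.hasFDerivAt.restrictScalars ℝ).comp z hu).congr_fderiv ?_
  ext v
  simp [wirtingerCLM_apply]
  ring

theorem hasFDerivAt_id_wirtinger (z : ℂ) : HasFDerivAt (fun w : ℂ => w) (wirtingerCLM 1 0) z := by
  refine (hasFDerivAt_id z).congr_fderiv ?_
  ext v
  simp [wirtingerCLM_apply]

theorem hasFDerivAt_conj_wirtinger (z : ℂ) :
    HasFDerivAt (fun w : ℂ => conj w) (wirtingerCLM 0 1) z := by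
  refine (Complex.conjCLE : ℂ →L[ℝ] ℂ).hasFDerivAt.congr_fderiv ?_
  ext v
  simp [wirtingerCLM_apply]

theorem continuous_wirtingerCLM : Continuous fun p : ℂ × ℂ => wirtingerCLM p.1 p.2 := by
  unfold wirtingerCLM
  fun_prop

/-! ### Differentiation under the integral sign -/

/-- Differentiation under an integral over a compact interval, for an integrand that is
continuous in the integration variable and has a jointly continuous derivative. -/
theorem hasFDerivAt_intervalIntegral_of_continuousOn {E : Type*} [NormedAddCommGroup E]
    [NormedSpace ℝ E] [ProperSpace E] {U : Set E} (hU : IsOpen U) {F : E → ℝ → ℂ}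
    {F' : E → ℝ → E →L[ℝ] ℂ} (hF : ∀ x ∈ U, Continuous (F x))
    (hF' : ContinuousOn (Function.uncurry F') (U ×ˢ Set.univ))
    (h : ∀ x ∈ U, ∀ t, HasFDerivAt (fun y => F y t) (F' x t) x) {x₀ : E} (hx₀ : x₀ ∈ U)
    (a b : ℝ) :
    HasFDerivAt (fun x => ∫ t in a..b, F x t) (∫ t in a..b, F' x₀ t) x₀ := by
  obtain ⟨ε, hε, hεU⟩ := Metric.nhds_basis_closedBall.mem_iff.1 (hU.mem_nhds hx₀)
  have hcpt : IsCompact (Metric.closedBall x₀ ε ×ˢ Set.uIcc a b) :=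
    (isCompact_closedBall _ _).prod isCompact_uIcc
  obtain ⟨C, hC⟩ := hcpt.exists_bound_of_continuousOn
    (hF'.mono (Set.prod_mono hεU (Set.subset_univ _)))
  have hcont : Continuous (F' x₀) := by
    rw [← continuousOn_univ]
    exact hF'.comp (f := fun t : ℝ => (x₀, t)) (by fun_prop) (fun t _ => ⟨hx₀, trivial⟩)
  refine intervalIntegral.hasFDerivAt_integral_of_dominated_of_fderiv_le (𝕜 := ℝ)
    (s := Metric.closedBall x₀ ε) (bound := fun _ => C) (Metric.closedBall_mem_nhds _ hε) ?_
    ((hF x₀ hx₀).intervalIntegrable _ _) hcont.aestronglyMeasurable ?_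
    intervalIntegrable_const ?_
  · filter_upwards [hU.mem_nhds hx₀] with x hx using (hF x hx).aestronglyMeasurable
  · exact .of_forall fun t ht x hx => hC (x, t) ⟨hx, Set.uIoc_subset_uIcc ht⟩
  · exact .of_forall fun t _ x hx => h x (hεU hx) t

/-! ### Fourier coefficients on circles -/

/-- The `k`-th Fourier coefficient of `θ ↦ u (r e^{iθ})`, without the factor `1 / (2π)`. The radius
may be any real number, so that `r = 0` is an interior point of the range `-1 < r < 1` on which the
coefficient of a function of class `C¹` on the unit disk is differentiable. -/
noncomputable def circleCoeff (u : ℂ → ℂ) (k : ℤ) (r : ℝ) : ℂ :=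
  ∫ θ in (0 : ℝ)..(2 * Real.pi),
    u (r * Complex.exp (θ * Complex.I)) * Complex.exp (-(k * θ * Complex.I))

theorem norm_ofReal_mul_exp (r θ : ℝ) : ‖(r : ℂ) * Complex.exp (θ * Complex.I)‖ = |r| := by
  rw [norm_mul, Complex.norm_exp_ofReal_mul_I, mul_one, Complex.norm_real, Real.norm_eq_abs]

theorem mul_exp_mem_ball {r : ℝ} (hr : r ∈ Set.Ioo (-1 : ℝ) 1) (θ : ℝ) :
    (r : ℂ) * Complex.exp (θ * Complex.I) ∈ Metric.ball (0 : ℂ) 1 := by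
  rw [mem_ball_zero_iff, norm_ofReal_mul_exp]
  exact abs_lt.2 hr

theorem continuous_comp_circle {u : ℂ → ℂ} (hu : ContinuousOn u (Metric.ball (0 : ℂ) 1)) {r : ℝ}
    (hr : r ∈ Set.Ioo (-1 : ℝ) 1) :
    Continuous fun θ : ℝ => u (r * Complex.exp (θ * Complex.I)) := by
  rw [← continuousOn_univ]
  exact hu.comp (by fun_prop) fun θ _ => mul_exp_mem_ball hr θ

theorem hasDerivAt_exp_mul_I (k : ℂ) (θ : ℝ) :
    HasDerivAt (fun t : ℝ => Complex.exp (k * t * Complex.I))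
      (k * Complex.I * Complex.exp (k * θ * Complex.I)) θ := by
  have h : HasDerivAt (fun t : ℝ => k * (t : ℂ) * Complex.I) (k * 1 * Complex.I) θ :=
    ((Complex.ofRealCLM.hasDerivAt.const_mul k).mul_const Complex.I)
  refine h.cexp.congr_deriv ?_
  ring

theorem exp_int_mul_two_pi_I (k : ℤ) :
    Complex.exp (k * ((2 * Real.pi : ℝ) : ℂ) * Complex.I) = 1 := by
  rw [← Complex.exp_int_mul_two_pi_mul_I k]
  push_cast
  ring_nf

/-- Differentiation of a Fourier coefficient with respect to the radius. -/
theorem hasDerivAt_circleCoeff_fderiv {u : ℂ → ℂ} (hu : ContDiffOn ℝ 1 u (Metric.ball (0 : ℂ) 1))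
    (k : ℤ) {r : ℝ} (hr : r ∈ Set.Ioo (-1 : ℝ) 1) :
    HasDerivAt (circleCoeff u k)
      (∫ θ in (0 : ℝ)..(2 * Real.pi), fderiv ℝ u (r * Complex.exp (θ * Complex.I))
        (Complex.exp (θ * Complex.I)) * Complex.exp (-(k * θ * Complex.I))) r := by
  have hfd : ContinuousOn (fderiv ℝ u) (Metric.ball (0 : ℂ) 1) :=
    hu.continuousOn_fderiv_of_isOpen Metric.isOpen_ball le_rfl
  have hF' : ContinuousOn (fun p : ℝ × ℝ => fderiv ℝ u (p.1 * Complex.exp (p.2 * Complex.I))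
      (Complex.exp (p.2 * Complex.I)) * Complex.exp (-(k * p.2 * Complex.I)))
      (Set.Ioo (-1 : ℝ) 1 ×ˢ Set.univ) := by
    have h1 : ContinuousOn (fun p : ℝ × ℝ => fderiv ℝ u (p.1 * Complex.exp (p.2 * Complex.I)))
        (Set.Ioo (-1 : ℝ) 1 ×ˢ Set.univ) :=
      hfd.comp (by fun_prop) fun p hp => mul_exp_mem_ball hp.1 p.2
    exact (h1.clm_apply (by fun_prop)).mul (by fun_prop)
  have key := hasFDerivAt_intervalIntegral_of_continuousOn (E := ℝ) isOpen_Ioo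
    (F := fun s θ => u (s * Complex.exp (θ * Complex.I)) * Complex.exp (-(k * θ * Complex.I)))
    (F' := fun s θ => ContinuousLinearMap.toSpanSingleton ℝ
      (fderiv ℝ u (s * Complex.exp (θ * Complex.I)) (Complex.exp (θ * Complex.I)) *
        Complex.exp (-(k * θ * Complex.I))))
    (fun s hs => (continuous_comp_circle hu.continuousOn hs).mul (by fun_prop))
    ((ContinuousLinearMap.toSpanSingletonCLE (𝕜 := ℝ) (E := ℂ)).continuous.comp_continuousOn hF')
    (fun s hs θ => by
      have h1 : HasDerivAt (fun y : ℝ => (y : ℂ) * Complex.exp (θ * Complex.I))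
          (1 * Complex.exp (θ * Complex.I)) s := Complex.ofRealCLM.hasDerivAt.mul_const _
      have h2 := (hu.contDiffAt (Metric.isOpen_ball.mem_nhds
        (mul_exp_mem_ball hs θ))).differentiableAt one_ne_zero |>.hasFDerivAt
      have h3 := (h2.comp_hasDerivAt s h1).mul_const (Complex.exp (-(k * θ * Complex.I)))
      rw [one_mul] at h3
      exact h3.hasFDerivAt) hr 0 (2 * Real.pi)
  have h4 := key.hasDerivAt
  rw [ContinuousLinearMap.intervalIntegral_apply] at h4
  · simp only [ContinuousLinearMap.toSpanSingleton_apply, one_smul] at h4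
    exact h4
  · refine Continuous.intervalIntegrable ?_ _ _
    refine (ContinuousLinearMap.toSpanSingletonCLE (𝕜 := ℝ) (E := ℂ)).continuous.comp ?_
    rw [← continuousOn_univ]
    exact hF'.comp (f := fun t : ℝ => (r, t)) (by fun_prop) (fun t _ => ⟨hr, trivial⟩)

/-- Integration by parts in the angle. -/
theorem integral_fderiv_circle_tangent {u : ℂ → ℂ}
    (hu : ContDiffOn ℝ 1 u (Metric.ball (0 : ℂ) 1)) (k : ℤ) {r : ℝ}
    (hr : r ∈ Set.Ioo (-1 : ℝ) 1) :
    ∫ θ in (0 : ℝ)..(2 * Real.pi), fderiv ℝ u (r * Complex.exp (θ * Complex.I))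
        (r * (Complex.I * Complex.exp (θ * Complex.I))) * Complex.exp (-(k * θ * Complex.I)) =
      k * Complex.I * circleCoeff u k r := by
  have hfd : Continuous fun θ : ℝ => fderiv ℝ u (r * Complex.exp (θ * Complex.I)) := by
    rw [← continuousOn_univ]
    exact (hu.continuousOn_fderiv_of_isOpen Metric.isOpen_ball le_rfl).comp (by fun_prop)
      fun θ _ => mul_exp_mem_ball hr θ
  have hc := continuous_comp_circle hu.continuousOn hr
  have hder : ∀ θ : ℝ, HasDerivAt
      (fun t : ℝ => u (r * Complex.exp (t * Complex.I)) * Complex.exp (-(k * t * Complex.I)))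
      (fderiv ℝ u (r * Complex.exp (θ * Complex.I))
        (r * (Complex.I * Complex.exp (θ * Complex.I))) * Complex.exp (-(k * θ * Complex.I)) -
        k * Complex.I * (u (r * Complex.exp (θ * Complex.I)) *
          Complex.exp (-(k * θ * Complex.I)))) θ := by
    intro θ
    have h1 := (hasDerivAt_exp_mul_I 1 θ).const_mul (r : ℂ)
    have h2 := (hu.contDiffAt (Metric.isOpen_ball.mem_nhds
        (mul_exp_mem_ball hr θ))).differentiableAt one_ne_zero |>.hasFDerivAt
    simp only [one_mul] at h1
    have h3 := (h2.comp_hasDerivAt θ h1).mul (hasDerivAt_exp_mul_I (-k) θ)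
    simp only [neg_mul] at h3
    refine h3.congr_deriv ?_
    simp only [Function.comp_apply]
    ring
  have hA : Continuous fun θ : ℝ => fderiv ℝ u (r * Complex.exp (θ * Complex.I))
      (r * (Complex.I * Complex.exp (θ * Complex.I))) * Complex.exp (-(k * θ * Complex.I)) :=
    (hfd.clm_apply (by fun_prop)).mul (by fun_prop)
  have hB : Continuous fun θ : ℝ => k * Complex.I * (u (r * Complex.exp (θ * Complex.I)) *
      Complex.exp (-(k * θ * Complex.I))) := continuous_const.mul (hc.mul (by fun_prop))
  have h5 := intervalIntegral.integral_eq_sub_of_hasDerivAt (a := 0) (b := 2 * Real.pi)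
    (fun θ _ => hder θ) ((hA.sub hB).intervalIntegrable _ _)
  rw [intervalIntegral.integral_sub (hA.intervalIntegrable _ _) (hB.intervalIntegrable _ _),
    intervalIntegral.integral_const_mul] at h5
  have e1 : Complex.exp (((2 * Real.pi : ℝ) : ℂ) * Complex.I) = 1 := by
    have := exp_int_mul_two_pi_I 1
    rwa [Int.cast_one, one_mul] at this
  have e2 : Complex.exp (-(k * ((2 * Real.pi : ℝ) : ℂ) * Complex.I)) = 1 := by
    rw [Complex.exp_neg, exp_int_mul_two_pi_I, inv_one]
  rw [e1, e2] at h5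
  simp only [Complex.ofReal_zero, zero_mul, mul_zero, neg_zero, Complex.exp_zero, sub_self] at h5
  exact sub_eq_zero.1 h5

theorem conj_exp_mul_I (θ : ℝ) :
    conj (Complex.exp (θ * Complex.I)) = Complex.exp (-(θ * Complex.I)) := by
  rw [← Complex.exp_conj, map_mul, Complex.conj_ofReal, Complex.conj_I, mul_neg]

theorem ContDiffOn.continuousOn_wirtingerZ {u : ℂ → ℂ}
    (hu : ContDiffOn ℝ 1 u (Metric.ball (0 : ℂ) 1)) :
    ContinuousOn (wirtingerZ u) (Metric.ball (0 : ℂ) 1) := by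
  have := hu.continuousOn_fderiv_of_isOpen Metric.isOpen_ball le_rfl
  unfold wirtingerZ
  fun_prop

theorem ContDiffOn.continuousOn_wirtingerZBar {u : ℂ → ℂ}
    (hu : ContDiffOn ℝ 1 u (Metric.ball (0 : ℂ) 1)) :
    ContinuousOn (wirtingerZBar u) (Metric.ball (0 : ℂ) 1) := by
  have := hu.continuousOn_fderiv_of_isOpen Metric.isOpen_ball le_rfl
  unfold wirtingerZBar
  fun_prop

/-- The polar form of `∂_z` and `∂_z̄`: the radial derivative of a Fourier coefficient is the sum
of the coefficients of the two Wirtinger derivatives, with indices `k - 1` and `k + 1`, and `k / r`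
times the coefficient is their difference. -/
theorem hasDerivAt_circleCoeff_add {u : ℂ → ℂ} (hu : ContDiffOn ℝ 1 u (Metric.ball (0 : ℂ) 1))
    (k : ℤ) {r : ℝ} (hr : r ∈ Set.Ioo (-1 : ℝ) 1) :
    HasDerivAt (circleCoeff u k)
      (circleCoeff (wirtingerZ u) (k - 1) r + circleCoeff (wirtingerZBar u) (k + 1) r) r ∧
    k * circleCoeff u k r =
      r * (circleCoeff (wirtingerZ u) (k - 1) r - circleCoeff (wirtingerZBar u) (k + 1) r) := by
  have hz := continuous_comp_circle hu.continuousOn_wirtingerZ hr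
  have hb := continuous_comp_circle hu.continuousOn_wirtingerZBar hr
  have em : ∀ θ : ℝ, Complex.exp (-(((k - 1 : ℤ) : ℂ) * θ * Complex.I)) =
      Complex.exp (θ * Complex.I) * Complex.exp (-(k * θ * Complex.I)) := fun θ => by
    rw [← Complex.exp_add]; push_cast; ring_nf
  have ep : ∀ θ : ℝ, Complex.exp (-(((k + 1 : ℤ) : ℂ) * θ * Complex.I)) =
      Complex.exp (-(θ * Complex.I)) * Complex.exp (-(k * θ * Complex.I)) := fun θ => by
    rw [← Complex.exp_add]; push_cast; ring_nf
  constructor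
  · refine (hasDerivAt_circleCoeff_fderiv hu k hr).congr_deriv ?_
    rw [circleCoeff, circleCoeff, ← intervalIntegral.integral_add
      (Continuous.intervalIntegrable (by fun_prop) _ _)
      (Continuous.intervalIntegrable (by fun_prop) _ _)]
    refine intervalIntegral.integral_congr fun θ _ => ?_
    simp only [em, ep]
    rw [fderiv_eq_wirtingerCLM, wirtingerCLM_apply, conj_exp_mul_I]
    ring
  · have h := integral_fderiv_circle_tangent hu k hr
    have h2 : (k : ℂ) * circleCoeff u k r = -Complex.I * (k * Complex.I * circleCoeff u k r) := by
      linear_combination (k * circleCoeff u k r) * Complex.I_sq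
    rw [h2, ← h, circleCoeff, circleCoeff, ← intervalIntegral.integral_sub
      (Continuous.intervalIntegrable (by fun_prop) _ _)
      (Continuous.intervalIntegrable (by fun_prop) _ _), ← intervalIntegral.integral_const_mul,
      ← intervalIntegral.integral_const_mul]
    refine intervalIntegral.integral_congr fun θ _ => ?_
    simp only [em, ep]
    rw [fderiv_eq_wirtingerCLM, wirtingerCLM_apply, map_mul, map_mul, conj_exp_mul_I,
      Complex.conj_I, Complex.conj_ofReal]
    set x := wirtingerZ u (r * Complex.exp (θ * Complex.I))
    set y := wirtingerZBar u (r * Complex.exp (θ * Complex.I))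
    linear_combination (-(x * r * Complex.exp (θ * Complex.I) -
      y * r * Complex.exp (-(θ * Complex.I))) * Complex.exp (-(k * θ * Complex.I))) * Complex.I_sq

theorem hasDerivAt_circleCoeff_zBar {u : ℂ → ℂ} (hu : ContDiffOn ℝ 1 u (Metric.ball (0 : ℂ) 1))
    (k : ℤ) {r : ℝ} (hr : r ∈ Set.Ioo (0 : ℝ) 1) :
    HasDerivAt (circleCoeff u k)
      (k / r * circleCoeff u k r + 2 * circleCoeff (wirtingerZBar u) (k + 1) r) r := by
  obtain ⟨h1, h2⟩ := hasDerivAt_circleCoeff_add hu k (Set.Ioo_subset_Ioo_left (by norm_num) hr)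
  refine h1.congr_deriv ?_
  have : (r : ℂ) ≠ 0 := Complex.ofReal_ne_zero.2 hr.1.ne'
  rw [div_mul_eq_mul_div, h2]
  field_simp
  ring

theorem hasDerivAt_circleCoeff_z {u : ℂ → ℂ} (hu : ContDiffOn ℝ 1 u (Metric.ball (0 : ℂ) 1))
    (k : ℤ) {r : ℝ} (hr : r ∈ Set.Ioo (0 : ℝ) 1) :
    HasDerivAt (circleCoeff u k)
      (-k / r * circleCoeff u k r + 2 * circleCoeff (wirtingerZ u) (k - 1) r) r := by
  obtain ⟨h1, h2⟩ := hasDerivAt_circleCoeff_add hu k (Set.Ioo_subset_Ioo_left (by norm_num) hr)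
  refine h1.congr_deriv ?_
  have : (r : ℂ) ≠ 0 := Complex.ofReal_ne_zero.2 hr.1.ne'
  rw [neg_div, neg_mul, div_mul_eq_mul_div, h2]
  field_simp
  ring

/-! ### The radial equation of an `α`-harmonic function -/

/-- The solutions of `y' = (k / r) y` on `(0, 1)` are the multiples of `r ^ k`. -/
theorem exists_eq_mul_zpow_of_hasDerivAt {y : ℝ → ℂ} (k : ℤ)
    (h : ∀ r ∈ Set.Ioo (0 : ℝ) 1, HasDerivAt y (k / r * y r) r) :
    ∃ c : ℂ, ∀ r ∈ Set.Ioo (0 : ℝ) 1, y r = c * (r : ℂ) ^ k := by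
  have hd : ∀ r ∈ Set.Ioo (0 : ℝ) 1, HasDerivAt (fun s : ℝ => y s * (s : ℂ) ^ (-k)) 0 r := by
    intro r hr
    have hr0 : (r : ℂ) ≠ 0 := Complex.ofReal_ne_zero.2 hr.1.ne'
    have h1 : HasDerivAt (fun s : ℝ => (s : ℂ) ^ (-k)) (((-k : ℤ) : ℂ) * (r : ℂ) ^ (-k - 1)) r :=
      (hasDerivAt_zpow (-k) (r : ℂ) (Or.inl hr0)).comp_ofReal
    refine ((h r hr).mul h1).congr_deriv ?_
    rw [zpow_sub_one₀ hr0]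
    push_cast
    field_simp
    ring
  refine ⟨y (1 / 2) * ((1 / 2 : ℝ) : ℂ) ^ (-k), fun r hr => ?_⟩
  have h2 := isOpen_Ioo.is_const_of_deriv_eq_zero isPreconnected_Ioo
    (fun x hx => (hd x hx).differentiableAt.differentiableWithinAt) (fun x hx => (hd x hx).deriv)
    hr (show (1 / 2 : ℝ) ∈ Set.Ioo (0 : ℝ) 1 by norm_num)
  have hr0 : (r : ℂ) ≠ 0 := Complex.ofReal_ne_zero.2 hr.1.ne'
  rw [← h2, mul_assoc, ← zpow_add₀ hr0, neg_add_cancel, zpow_zero, mul_one]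

/-- A negative power of `r` is unbounded at `0`, so its coefficient vanishes in a function that is
continuous at `0`. -/
theorem eq_zero_of_eq_mul_zpow_neg {y : ℝ → ℂ} (hy : ContinuousAt y 0) {k : ℤ} (hk : k < 0)
    {c : ℂ} (h : ∀ r ∈ Set.Ioo (0 : ℝ) 1, y r = c * (r : ℂ) ^ k) : c = 0 := by
  obtain ⟨m, rfl⟩ : ∃ m : ℕ, k = -((m + 1 : ℕ) : ℤ) := ⟨(-k - 1).toNat, by omega⟩
  have h1 : Filter.Tendsto (fun r : ℝ => y r * (r : ℂ) ^ (m + 1)) (nhdsWithin 0 (Set.Ioi 0))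
      (nhds (y 0 * ((0 : ℝ) : ℂ) ^ (m + 1))) :=
    ((hy.mul (by fun_prop : ContinuousAt (fun r : ℝ => (r : ℂ) ^ (m + 1)) 0)).tendsto).mono_left
      nhdsWithin_le_nhds
  have h2 : Filter.Tendsto (fun r : ℝ => y r * (r : ℂ) ^ (m + 1)) (nhdsWithin 0 (Set.Ioi 0))
      (nhds c) := by
    refine tendsto_const_nhds.congr' ?_
    filter_upwards [Ioo_mem_nhdsGT (show (0 : ℝ) < 1 by norm_num)] with r hr
    have hr0 : (r : ℂ) ≠ 0 := Complex.ofReal_ne_zero.2 hr.1.ne'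
    rw [h r hr, zpow_neg, zpow_natCast, mul_assoc, inv_mul_cancel₀ (pow_ne_zero _ hr0), mul_one]
  simpa using tendsto_nhds_unique h2 h1

theorem continuousAt_circleCoeff_zero {u : ℂ → ℂ}
    (hu : ContDiffOn ℝ 1 u (Metric.ball (0 : ℂ) 1)) (k : ℤ) :
    ContinuousAt (circleCoeff u k) 0 :=
  (hasDerivAt_circleCoeff_fderiv hu k (by norm_num)).continuousAt

theorem circleCoeff_congr {u v : ℂ → ℂ} (h : ∀ z ∈ Metric.ball (0 : ℂ) 1, u z = v z) (k : ℤ)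
    {r : ℝ} (hr : r ∈ Set.Ioo (-1 : ℝ) 1) : circleCoeff u k r = circleCoeff v k r :=
  intervalIntegral.integral_congr fun θ _ => by
    simp only [h _ (mul_exp_mem_ball hr θ)]

theorem circleCoeff_zero_fun (k : ℤ) (r : ℝ) : circleCoeff (fun _ => 0) k r = 0 := by
  simp [circleCoeff]

theorem contDiffOn_wirtingerZBar {f : ℂ → ℂ} (hf : ContDiffOn ℝ 2 f (Metric.ball (0 : ℂ) 1)) :
    ContDiffOn ℝ 1 (wirtingerZBar f) (Metric.ball (0 : ℂ) 1) := by
  have h : ContDiffOn ℝ 1 (fderiv ℝ f) (Metric.ball (0 : ℂ) 1) :=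
    hf.fderiv_of_isOpen Metric.isOpen_ball (by norm_num)
  unfold wirtingerZBar
  exact contDiffOn_const.mul ((h.clm_apply contDiffOn_const).add
    (contDiffOn_const.mul (h.clm_apply contDiffOn_const)))

theorem one_sub_norm_sq_pos {z : ℂ} (hz : z ∈ Metric.ball (0 : ℂ) 1) : 0 < 1 - ‖z‖ ^ 2 := by
  have h := mem_ball_zero_iff.1 hz
  have := norm_nonneg z
  nlinarith

theorem contDiffOn_one_sub_norm_sq_rpow (p : ℝ) :
    ContDiffOn ℝ 2 (fun w : ℂ => (((1 - ‖w‖ ^ 2) ^ p : ℝ) : ℂ)) (Metric.ball (0 : ℂ) 1) := by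
  refine Complex.ofRealCLM.contDiff.comp_contDiffOn (f := fun w : ℂ => (1 - ‖w‖ ^ 2) ^ p) ?_
  exact (contDiffOn_const.sub (contDiff_norm_sq ℝ).contDiffOn).rpow_const_of_ne
    fun z hz => (one_sub_norm_sq_pos hz).ne'

/-- `(1 - |z|²)^(-α) ∂_z̄ f` is antiholomorphic when `f` is `α`-harmonic. So the `(k+1)`-st Fourier
coefficients of `∂_z̄ f` on circles are multiples of one function of the radius, and they vanish
for `k ≥ 0`. -/
theorem IsAlphaHarmonic.exists_circleCoeff_zBar {α : ℝ} {f : ℂ → ℂ} (hf : IsAlphaHarmonic α f)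
    (k : ℤ) : ∃ b : ℂ, (0 ≤ k → b = 0) ∧ ∀ r ∈ Set.Ioo (0 : ℝ) 1,
      circleCoeff (wirtingerZBar f) (k + 1) r =
        b * ((((1 - r ^ 2) ^ α : ℝ) : ℂ) * (r : ℂ) ^ (-(k + 1))) := by
  set g : ℂ → ℂ := fun w => (((1 - ‖w‖ ^ 2) ^ (-α) : ℝ) : ℂ) * wirtingerZBar f w with hg
  have hgC : ContDiffOn ℝ 1 g (Metric.ball (0 : ℂ) 1) :=
    ((contDiffOn_one_sub_norm_sq_rpow (-α)).of_le (by norm_num)).mul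
      (contDiffOn_wirtingerZBar hf.contDiffOn)
  obtain ⟨b, hb⟩ := exists_eq_mul_zpow_of_hasDerivAt (y := circleCoeff g (k + 1)) (-(k + 1)) (by
    intro r hr
    refine (hasDerivAt_circleCoeff_z hgC (k + 1) hr).congr_deriv ?_
    rw [circleCoeff_congr (u := wirtingerZ g) hf.weightedLaplacian_eq_zero _
      (Set.Ioo_subset_Ioo_left (by norm_num) hr), circleCoeff_zero_fun]
    push_cast
    ring)
  refine ⟨b, fun hk => eq_zero_of_eq_mul_zpow_neg (continuousAt_circleCoeff_zero hgC _)
    (by omega) hb, fun r hr => ?_⟩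
  have hpos : 0 < 1 - r ^ 2 := by nlinarith [hr.1, hr.2]
  have h1 : circleCoeff g (k + 1) r =
      (((1 - r ^ 2) ^ (-α) : ℝ) : ℂ) * circleCoeff (wirtingerZBar f) (k + 1) r := by
    rw [circleCoeff, circleCoeff, ← intervalIntegral.integral_const_mul]
    refine intervalIntegral.integral_congr fun θ _ => ?_
    simp only [hg, norm_ofReal_mul_exp, sq_abs]
    ring
  have h2 : ((1 - r ^ 2) ^ α) * ((1 - r ^ 2) ^ (-α)) = 1 := by
    rw [← Real.rpow_add hpos, add_neg_cancel, Real.rpow_zero]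
  have h3 : (((1 - r ^ 2) ^ α : ℝ) : ℂ) * (((1 - r ^ 2) ^ (-α) : ℝ) : ℂ) = 1 := by
    rw [← Complex.ofReal_mul, h2, Complex.ofReal_one]
  rw [mul_left_comm, ← hb r hr, h1, ← mul_assoc, h3, one_mul]

/-- The `k`-th Fourier coefficients of `α`-harmonic functions, as functions of the radius, form a
space of dimension at most one. -/
theorem IsAlphaHarmonic.exists_circleCoeff_eq_mul {α : ℝ} {f h : ℂ → ℂ}
    (hf : IsAlphaHarmonic α f) (hh : IsAlphaHarmonic α h) (k : ℤ)
    (hne : ∃ r ∈ Set.Ioo (0 : ℝ) 1, circleCoeff h k r ≠ 0) :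
    ∃ c : ℂ, ∀ r ∈ Set.Ioo (0 : ℝ) 1, circleCoeff f k r = c * circleCoeff h k r := by
  have hf1 := hf.contDiffOn.of_le (show (1 : WithTop ℕ∞) ≤ 2 by norm_num)
  have hh1 := hh.contDiffOn.of_le (show (1 : WithTop ℕ∞) ≤ 2 by norm_num)
  obtain ⟨b, hb0, hb⟩ := hf.exists_circleCoeff_zBar k
  obtain ⟨d, hd0, hd⟩ := hh.exists_circleCoeff_zBar k
  obtain ⟨s, hs, hsne⟩ := hne
  -- A combination of `f` and `h` in which the antiholomorphic parts cancel satisfies the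
  -- homogeneous equation, so its coefficient is a multiple of `r ^ k`.
  have comb : ∀ x y : ℂ, x * b = y * d → ∃ c : ℂ, ∀ r ∈ Set.Ioo (0 : ℝ) 1,
      x * circleCoeff f k r - y * circleCoeff h k r = c * (r : ℂ) ^ k := by
    intro x y hxy
    refine exists_eq_mul_zpow_of_hasDerivAt k fun r hr => ?_
    refine (((hasDerivAt_circleCoeff_zBar hf1 k hr).const_mul x).sub
      ((hasDerivAt_circleCoeff_zBar hh1 k hr).const_mul y)).congr_deriv ?_
    rw [hb r hr, hd r hr]
    linear_combination
      2 * ((((1 - r ^ 2) ^ α : ℝ) : ℂ) * (r : ℂ) ^ (-(k + 1))) * hxy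
  rcases le_or_gt 0 k with hk | hk
  · obtain ⟨c, hc⟩ := comb 1 0 (by rw [hb0 hk]; ring)
    obtain ⟨c', hc'⟩ := comb 0 (-1) (by rw [hd0 hk]; ring)
    simp only [one_mul, zero_mul, sub_zero, zero_sub, neg_mul, neg_neg] at hc hc'
    have hc0 : c' ≠ 0 := fun h0 => hsne (by rw [hc' s hs, h0, zero_mul])
    refine ⟨c / c', fun r hr => ?_⟩
    rw [hc r hr, hc' r hr]
    field_simp
  · -- For `k < 0` the power `r ^ k` is singular at the origin, so the combination vanishes.
    have comb0 : ∀ x y : ℂ, x * b = y * d → ∀ r ∈ Set.Ioo (0 : ℝ) 1,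
        x * circleCoeff f k r = y * circleCoeff h k r := by
      intro x y hxy r hr
      obtain ⟨c, hc⟩ := comb x y hxy
      have hc0 := eq_zero_of_eq_mul_zpow_neg
        (y := fun r => x * circleCoeff f k r - y * circleCoeff h k r)
        (((continuousAt_circleCoeff_zero hf1 k).const_mul x).sub
          ((continuousAt_circleCoeff_zero hh1 k).const_mul y)) hk hc
      have := hc r hr
      rw [hc0, zero_mul] at this
      exact sub_eq_zero.1 this
    have hd : d ≠ 0 := fun h0 => hsne (by simpa using (comb0 0 1 (by rw [h0]; ring) s hs).symm)
    refine ⟨b / d, fun r hr => ?_⟩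
    have := comb0 1 (b / d) (by field_simp) r hr
    simpa using this

/-! ### The kernel -/

/-- The Poisson kernel of the weighted Laplacian with pole `1`,
`K(z) = (1 - |z|²)^(α+1) / ((1 - z) (1 - z̄)^(α+1))`. All powers are principal branches, taken at
points of the open right half-plane when `z` is in the unit disk. -/
noncomputable def alphaKernel (α : ℝ) (z : ℂ) : ℂ :=
  (1 - z * conj z) ^ ((α + 1 : ℝ) : ℂ) * (1 - z)⁻¹ * (1 - conj z) ^ ((-(α + 1) : ℝ) : ℂ)

/-- The derivative `∂_z K`, as a rational multiple of `K`. -/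
noncomputable def alphaKernelZ (α : ℝ) (z : ℂ) : ℂ :=
  alphaKernel α z * (1 - conj z - α * conj z * (1 - z)) / ((1 - z * conj z) * (1 - z))

/-- The derivative `∂_z̄ K`, which is `(1 - |z|²)^α` times an antiholomorphic function. -/
noncomputable def alphaKernelZBar (α : ℝ) (z : ℂ) : ℂ :=
  (α + 1) * ((1 - z * conj z) ^ (α : ℂ) * (1 - conj z) ^ ((-(α + 2) : ℝ) : ℂ))

theorem one_sub_mem_slitPlane {z : ℂ} (hz : z ∈ Metric.ball (0 : ℂ) 1) :
    1 - z ∈ Complex.slitPlane := by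
  refine Or.inl ?_
  have h := (Complex.re_le_norm z).trans_lt (mem_ball_zero_iff.1 hz)
  simpa using h

theorem conj_mem_ball {z : ℂ} (hz : z ∈ Metric.ball (0 : ℂ) 1) :
    conj z ∈ Metric.ball (0 : ℂ) 1 := by
  simpa using hz

theorem one_sub_mul_conj (z : ℂ) : 1 - z * conj z = ((1 - ‖z‖ ^ 2 : ℝ) : ℂ) := by
  rw [Complex.mul_conj']
  push_cast
  rfl

theorem one_sub_mul_conj_mem_slitPlane {z : ℂ} (hz : z ∈ Metric.ball (0 : ℂ) 1) :
    1 - z * conj z ∈ Complex.slitPlane := by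
  rw [one_sub_mul_conj]
  exact Complex.ofReal_mem_slitPlane.2 (one_sub_norm_sq_pos hz)

theorem one_sub_mul_conj_cpow {z : ℂ} (hz : z ∈ Metric.ball (0 : ℂ) 1) (p : ℝ) :
    (1 - z * conj z) ^ (p : ℂ) = (((1 - ‖z‖ ^ 2) ^ p : ℝ) : ℂ) := by
  rw [one_sub_mul_conj, Complex.ofReal_cpow (one_sub_norm_sq_pos hz).le]

theorem hasFDerivAt_one_sub_conj_cpow (p : ℝ) {z : ℂ} (hz : z ∈ Metric.ball (0 : ℂ) 1) :
    HasFDerivAt (fun w : ℂ => (1 - conj w) ^ (p : ℂ))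
      (wirtingerCLM 0 (-p * (1 - conj z) ^ ((p - 1 : ℝ) : ℂ))) z := by
  have h1 : HasDerivAt (fun w : ℂ => (1 - w) ^ (p : ℂ))
      (p * (1 - conj z) ^ ((p : ℂ) - 1) * -1) (conj z) :=
    (((hasDerivAt_id (conj z)).const_sub 1)).cpow_const (one_sub_mem_slitPlane (conj_mem_ball hz))
  convert h1.wirtinger_comp (hasFDerivAt_conj_wirtinger z) using 2
  · ring
  · push_cast; ring

theorem hasFDerivAt_one_sub_mul_conj_cpow (p : ℝ) {z : ℂ} (hz : z ∈ Metric.ball (0 : ℂ) 1) :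
    HasFDerivAt (fun w : ℂ => (1 - w * conj w) ^ (p : ℂ))
      (wirtingerCLM (-p * (1 - z * conj z) ^ ((p - 1 : ℝ) : ℂ) * conj z)
        (-p * (1 - z * conj z) ^ ((p - 1 : ℝ) : ℂ) * z)) z := by
  have h1 : HasDerivAt (fun w : ℂ => (1 - w) ^ (p : ℂ))
      (p * (1 - z * conj z) ^ ((p : ℂ) - 1) * -1) (z * conj z) :=
    (((hasDerivAt_id (z * conj z)).const_sub 1)).cpow_const (one_sub_mul_conj_mem_slitPlane hz)
  convert HasDerivAt.wirtinger_comp (u := fun w => w * conj w) h1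
    ((hasFDerivAt_id_wirtinger z).wirtinger_mul (hasFDerivAt_conj_wirtinger z)) using 2
  · push_cast; ring
  · push_cast; ring

theorem hasFDerivAt_alphaKernel (α : ℝ) {z : ℂ} (hz : z ∈ Metric.ball (0 : ℂ) 1) :
    HasFDerivAt (alphaKernel α) (wirtingerCLM (alphaKernelZ α z) (alphaKernelZBar α z)) z := by
  have h1 : 1 - z ≠ 0 := Complex.slitPlane_ne_zero (one_sub_mem_slitPlane hz)
  have h2 : 1 - z * conj z ≠ 0 := Complex.slitPlane_ne_zero (one_sub_mul_conj_mem_slitPlane hz)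
  have h3 : 1 - conj z ≠ 0 :=
    Complex.slitPlane_ne_zero (one_sub_mem_slitPlane (conj_mem_ball hz))
  have hQ : HasDerivAt (fun w : ℂ => (1 - w)⁻¹) (-(-1) / (1 - z) ^ 2) z :=
    ((hasDerivAt_id z).const_sub 1).inv h1
  have hK := ((hasFDerivAt_one_sub_mul_conj_cpow (α + 1) hz).wirtinger_mul
    (hQ.wirtinger_comp (hasFDerivAt_id_wirtinger z))).wirtinger_mul
    (hasFDerivAt_one_sub_conj_cpow (-(α + 1)) hz)
  have e1 : (1 - z * conj z) ^ ((α + 1 : ℝ) : ℂ) =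
      (1 - z * conj z) ^ (α : ℂ) * (1 - z * conj z) := by
    rw [Complex.ofReal_add, Complex.ofReal_one, Complex.cpow_add _ _ h2, Complex.cpow_one]
  have e2 : (1 - conj z) ^ ((-(α + 1) : ℝ) : ℂ) =
      (1 - conj z) ^ ((-(α + 2) : ℝ) : ℂ) * (1 - conj z) := by
    rw [show (-(α + 1) : ℝ) = -(α + 2) + 1 by ring, Complex.ofReal_add, Complex.ofReal_one,
      Complex.cpow_add _ _ h3, Complex.cpow_one]
  refine hK.congr_fderiv ?_
  rw [add_sub_cancel_right, show (-(α + 1) - 1 : ℝ) = -(α + 2) by ring]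
  simp only [alphaKernelZ, alphaKernelZBar, alphaKernel, e1, e2]
  set P := (1 - z * conj z) ^ (α : ℂ)
  set S := (1 - conj z) ^ ((-(α + 2) : ℝ) : ℂ)
  congr 1
  · rw [eq_div_iff (mul_ne_zero h2 h1)]
    push_cast
    field_simp
    ring
  · push_cast
    field_simp
    ring

theorem contDiffOn_cpow_comp {u : ℂ → ℂ} {s : Set ℂ} (hu : ContDiff ℝ 2 u)
    (hs : ∀ z ∈ s, u z ∈ Complex.slitPlane) (c : ℂ) :
    ContDiffOn ℝ 2 (fun w => u w ^ c) s := fun z hz =>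
  (((analyticAt_id.cpow analyticAt_const (hs z hz)).contDiffAt (n := 2)).restrict_scalars ℝ
    |>.comp z hu.contDiffAt).contDiffWithinAt

theorem contDiffOn_alphaKernel (α : ℝ) :
    ContDiffOn ℝ 2 (alphaKernel α) (Metric.ball (0 : ℂ) 1) := by
  have hc : ContDiff ℝ 2 (fun w : ℂ => conj w) := (Complex.conjCLE : ℂ →L[ℝ] ℂ).contDiff
  refine ((contDiffOn_cpow_comp (contDiff_const.sub (contDiff_id.mul hc))
    (fun z hz => one_sub_mul_conj_mem_slitPlane hz) _).mul ?_).mul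
    (contDiffOn_cpow_comp (contDiff_const.sub hc)
      (fun z hz => one_sub_mem_slitPlane (conj_mem_ball hz)) _)
  exact (contDiffOn_const.sub contDiffOn_id).inv
    fun z hz => Complex.slitPlane_ne_zero (one_sub_mem_slitPlane hz)

theorem isAlphaHarmonic_alphaKernel (α : ℝ) : IsAlphaHarmonic α (alphaKernel α) := by
  refine ⟨contDiffOn_alphaKernel α, fun z hz => ?_⟩
  have h1 : (fun w : ℂ => (((1 - ‖w‖ ^ 2) ^ (-α) : ℝ) : ℂ) * wirtingerZBar (alphaKernel α) w)
      =ᶠ[nhds z] fun w => ((α : ℂ) + 1) * (1 - conj w) ^ ((-(α + 2) : ℝ) : ℂ) := by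
    filter_upwards [Metric.isOpen_ball.mem_nhds hz] with w hw
    rw [wirtingerZBar_eq_of_hasFDerivAt (hasFDerivAt_alphaKernel α hw), alphaKernelZBar,
      ← one_sub_mul_conj_cpow hw, Complex.ofReal_neg, Complex.cpow_neg]
    have : (1 - w * conj w) ^ (α : ℂ) ≠ 0 := by
      rw [one_sub_mul_conj_cpow hw]
      exact Complex.ofReal_ne_zero.2 (Real.rpow_pos_of_pos (one_sub_norm_sq_pos hw) _).ne'
    field_simp
  have h2 : HasFDerivAt (fun w : ℂ => ((α : ℂ) + 1) * (1 - conj w) ^ ((-(α + 2) : ℝ) : ℂ))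
      (wirtingerCLM 0 ((α + 1) * (-((-(α + 2) : ℝ) : ℂ) *
        (1 - conj z) ^ ((-(α + 2) - 1 : ℝ) : ℂ)))) z := by
    refine ((hasFDerivAt_one_sub_conj_cpow (-(α + 2)) hz).const_mul ((α : ℂ) + 1)).congr_fderiv ?_
    ext v
    simp [wirtingerCLM_apply]
    ring
  rw [weightedLaplacian, wirtingerZ, h1.fderiv_eq]
  exact wirtingerZ_eq_of_hasFDerivAt h2

theorem norm_alphaKernel (α : ℝ) {z : ℂ} (hz : z ∈ Metric.ball (0 : ℂ) 1) :
    ‖alphaKernel α z‖ = (1 - ‖z‖ ^ 2) ^ (α + 1) * ‖1 - z‖ ^ (-(α + 2)) := by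
  have h1 : 0 < ‖1 - z‖ := norm_pos_iff.2 (Complex.slitPlane_ne_zero (one_sub_mem_slitPlane hz))
  have h2 : ‖1 - conj z‖ = ‖1 - z‖ := by
    rw [← Complex.norm_conj (1 - z), map_sub, map_one]
  rw [alphaKernel, norm_mul, norm_mul, Complex.norm_cpow_real, Complex.norm_cpow_real, norm_inv,
    h2, one_sub_mul_conj, Complex.norm_real, Real.norm_of_nonneg (one_sub_norm_sq_pos hz).le,
    mul_assoc, ← Real.rpow_neg_one, ← Real.rpow_add h1]
  congr 2
  ring

theorem norm_alphaKernelZ_le (α : ℝ) {z : ℂ} (hz : z ∈ Metric.ball (0 : ℂ) 1) :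
    ‖alphaKernelZ α z‖ ≤ (1 + |α|) / (1 - ‖z‖ ^ 2) * ‖alphaKernel α z‖ := by
  have h1 : 0 < ‖1 - z‖ := norm_pos_iff.2 (Complex.slitPlane_ne_zero (one_sub_mem_slitPlane hz))
  have h2 : ‖1 - conj z‖ = ‖1 - z‖ := by
    rw [← Complex.norm_conj (1 - z), map_sub, map_one]
  have h3 := one_sub_norm_sq_pos hz
  have h4 : ‖1 - conj z - α * conj z * (1 - z)‖ ≤ (1 + |α|) * ‖1 - z‖ := by
    refine (norm_sub_le _ _).trans ?_
    rw [norm_mul, norm_mul, h2, Complex.norm_conj, Complex.norm_real, Real.norm_eq_abs, add_mul,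
      one_mul]
    have : |α| * ‖z‖ ≤ |α| * 1 :=
      mul_le_mul_of_nonneg_left (mem_ball_zero_iff.1 hz).le (abs_nonneg α)
    rw [mul_one] at this
    gcongr
  rw [alphaKernelZ, norm_div, norm_mul, norm_mul, one_sub_mul_conj, Complex.norm_real,
    Real.norm_of_nonneg h3.le]
  calc ‖alphaKernel α z‖ * ‖1 - conj z - α * conj z * (1 - z)‖ / ((1 - ‖z‖ ^ 2) * ‖1 - z‖)
      ≤ ‖alphaKernel α z‖ * ((1 + |α|) * ‖1 - z‖) / ((1 - ‖z‖ ^ 2) * ‖1 - z‖) := by gcongr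
    _ = (1 + |α|) / (1 - ‖z‖ ^ 2) * ‖alphaKernel α z‖ := by field_simp

theorem norm_alphaKernelZBar {α : ℝ} (hα : -1 < α) {z : ℂ} (hz : z ∈ Metric.ball (0 : ℂ) 1) :
    ‖alphaKernelZBar α z‖ = (1 + α) / (1 - ‖z‖ ^ 2) * ‖alphaKernel α z‖ := by
  have h2 : ‖1 - conj z‖ = ‖1 - z‖ := by
    rw [← Complex.norm_conj (1 - z), map_sub, map_one]
  have h3 := one_sub_norm_sq_pos hz
  rw [norm_alphaKernel α hz, alphaKernelZBar, norm_mul, norm_mul, Complex.norm_cpow_real,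
    Complex.norm_cpow_real, h2, one_sub_mul_conj, Complex.norm_real, Real.norm_of_nonneg h3.le,
    Real.rpow_add_one h3.ne',
    show (α : ℂ) + 1 = ((1 + α : ℝ) : ℂ) by push_cast; ring, Complex.norm_real,
    Real.norm_of_nonneg (by linarith)]
  field_simp

/-! ### Boundary behaviour of the kernel -/

/-- The mean value property of an `α`-harmonic function at the origin. -/
theorem IsAlphaHarmonic.circleCoeff_zero {α : ℝ} {f : ℂ → ℂ} (hf : IsAlphaHarmonic α f) {r : ℝ}
    (hr : r ∈ Set.Ioo (0 : ℝ) 1) : circleCoeff f 0 r = 2 * Real.pi * f 0 := by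
  have hf1 := hf.contDiffOn.of_le (show (1 : WithTop ℕ∞) ≤ 2 by norm_num)
  obtain ⟨b, hb0, hb⟩ := hf.exists_circleCoeff_zBar 0
  obtain ⟨c, hc⟩ := exists_eq_mul_zpow_of_hasDerivAt (y := circleCoeff f 0) 0 fun s hs => by
    refine (hasDerivAt_circleCoeff_zBar hf1 0 hs).congr_deriv ?_
    rw [hb s hs, hb0 le_rfl]
    ring
  simp only [zpow_zero, mul_one] at hc
  have h1 : Filter.Tendsto (circleCoeff f 0) (nhdsWithin 0 (Set.Ioi 0))
      (nhds (circleCoeff f 0 0)) :=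
    (continuousAt_circleCoeff_zero hf1 0).tendsto.mono_left nhdsWithin_le_nhds
  have h2 : Filter.Tendsto (circleCoeff f 0) (nhdsWithin 0 (Set.Ioi 0)) (nhds c) := by
    refine tendsto_const_nhds.congr' ?_
    filter_upwards [Ioo_mem_nhdsGT (show (0 : ℝ) < 1 by norm_num)] with s hs using (hc s hs).symm
  rw [hc r hr, tendsto_nhds_unique h2 h1]
  simp [circleCoeff]

theorem norm_zpow_sub_one_le {ζ : ℂ} (hζ : ‖ζ‖ = 1) (k : ℤ) :
    ‖ζ ^ k - 1‖ ≤ |(k : ℝ)| * ‖ζ - 1‖ := by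
  have hnat : ∀ n : ℕ, ‖ζ ^ n - 1‖ ≤ n * ‖ζ - 1‖ := by
    intro n
    induction n with
    | zero => simp
    | succ n ih =>
      have : ζ ^ (n + 1) - 1 = ζ ^ n * (ζ - 1) + (ζ ^ n - 1) := by ring
      rw [this]
      refine (norm_add_le _ _).trans ?_
      rw [norm_mul, norm_pow, hζ, one_pow, one_mul]
      push_cast
      linarith
  have h0 : ζ ≠ 0 := norm_pos_iff.1 (by rw [hζ]; exact one_pos)
  obtain ⟨n, rfl | rfl⟩ := k.eq_nat_or_neg
  · simpa using hnat n
  · have : ζ ^ (-(n : ℤ)) - 1 = -(ζ ^ (-(n : ℤ)) * (ζ ^ n - 1)) := by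
      rw [mul_sub, ← zpow_natCast ζ n, ← zpow_add₀ h0]
      simp
    rw [this, norm_neg, norm_mul, norm_zpow, hζ, one_zpow, one_mul]
    simpa using hnat n

theorem one_sub_le_norm_one_sub {r : ℝ} (hr : 0 ≤ r) (θ : ℝ) :
    1 - r ≤ ‖1 - (r : ℂ) * Complex.exp (θ * Complex.I)‖ := by
  have h := norm_sub_norm_le 1 ((r : ℂ) * Complex.exp (θ * Complex.I))
  rwa [norm_ofReal_mul_exp, abs_of_nonneg hr, norm_one] at h

/-- The kernel is an approximate identity: each of its Fourier coefficients tends to that of the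
point mass at `1`. -/
theorem tendsto_circleCoeff_alphaKernel {α : ℝ} (hα : -1 < α) (k : ℤ) :
    Filter.Tendsto (circleCoeff (alphaKernel α) k) (nhdsWithin 1 (Set.Iio 1))
      (nhds (2 * Real.pi)) := by
  set e : ℝ → ℂ := fun θ => Complex.exp (θ * Complex.I) with he
  have hK := isAlphaHarmonic_alphaKernel α
  have hIoo : Set.Ioo (0 : ℝ) 1 ∈ nhdsWithin (1 : ℝ) (Set.Iio 1) := Ioo_mem_nhdsLT one_pos
  have hcont : ∀ r ∈ Set.Ioo (0 : ℝ) 1, Continuous fun θ => alphaKernel α (r * e θ) :=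
    fun r hr => continuous_comp_circle hK.contDiffOn.continuousOn
      (Set.Ioo_subset_Ioo_left (by norm_num) hr)
  have hbound : ∀ r ∈ Set.Ioo (0 : ℝ) 1, ∀ θ : ℝ,
      ‖alphaKernel α (r * e θ) * (Complex.exp (-(k * θ * Complex.I)) - 1)‖ ≤
        2 * |(k : ℝ)| * ((1 - r ^ 2) / ‖1 - r * e θ‖) ^ (α + 1) := by
    intro r hr θ
    have hball := mul_exp_mem_ball (Set.Ioo_subset_Ioo_left (by norm_num) hr) θ
    have hx : 0 < ‖1 - r * e θ‖ :=
      lt_of_lt_of_le (by linarith [hr.2]) (one_sub_le_norm_one_sub hr.1.le θ)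
    have hp : 0 < 1 - r ^ 2 := by nlinarith [hr.1, hr.2]
    have h1 : Complex.exp (-(k * θ * Complex.I)) = e θ ^ (-k) := by
      rw [he, ← Complex.exp_int_mul]
      push_cast
      ring_nf
    have hn : ‖e θ‖ = 1 := Complex.norm_exp_ofReal_mul_I θ
    -- The factor `e^{-ikθ} - 1` cancels one power of the singularity of the kernel.
    have h2 : ‖e θ - 1‖ ≤ 2 * ‖1 - r * e θ‖ := by
      have h3 : e θ - 1 = ((1 - r : ℝ) : ℂ) * e θ - (1 - r * e θ) := by push_cast; ring
      have h4 := one_sub_le_norm_one_sub hr.1.le θ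
      rw [h3]
      refine (norm_sub_le _ _).trans ?_
      rw [norm_mul, hn, mul_one, Complex.norm_real, Real.norm_of_nonneg (by linarith [hr.2])]
      linarith
    have h5 : ‖e θ ^ (-k) - 1‖ ≤ |(k : ℝ)| * (2 * ‖1 - r * e θ‖) := by
      refine (norm_zpow_sub_one_le hn (-k)).trans ?_
      push_cast
      rw [abs_neg]
      gcongr
    rw [norm_mul, h1, norm_alphaKernel α hball, norm_ofReal_mul_exp, sq_abs,
      Real.div_rpow hp.le hx.le]
    calc (1 - r ^ 2) ^ (α + 1) * ‖1 - r * e θ‖ ^ (-(α + 2)) * ‖e θ ^ (-k) - 1‖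
        ≤ (1 - r ^ 2) ^ (α + 1) * ‖1 - r * e θ‖ ^ (-(α + 2)) *
          (|(k : ℝ)| * (2 * ‖1 - r * e θ‖)) := by gcongr
      _ = 2 * |(k : ℝ)| * ((1 - r ^ 2) ^ (α + 1) *
          (‖1 - r * e θ‖ ^ (-(α + 2)) * ‖1 - r * e θ‖)) := by ring
      _ = 2 * |(k : ℝ)| * ((1 - r ^ 2) ^ (α + 1) / ‖1 - r * e θ‖ ^ (α + 1)) := by
        rw [← Real.rpow_add_one hx.ne', div_eq_mul_inv, ← Real.rpow_neg hx.le]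
        ring_nf
  have hlim : Filter.Tendsto (fun r : ℝ => ∫ θ in (0 : ℝ)..(2 * Real.pi),
      alphaKernel α (r * e θ) * (Complex.exp (-(k * θ * Complex.I)) - 1))
      (nhdsWithin 1 (Set.Iio 1)) (nhds (∫ θ in (0 : ℝ)..(2 * Real.pi), (0 : ℂ))) := by
    refine intervalIntegral.tendsto_integral_filter_of_dominated_convergence
      (fun _ => 2 * |(k : ℝ)| * 2 ^ (α + 1)) ?_ ?_ intervalIntegrable_const ?_
    · filter_upwards [hIoo] with r hr
      exact ((hcont r hr).mul (by fun_prop)).aestronglyMeasurable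
    · filter_upwards [hIoo] with r hr
      refine .of_forall fun θ _ => (hbound r hr θ).trans ?_
      have h4 := one_sub_le_norm_one_sub hr.1.le θ
      have hx : 0 < ‖1 - r * e θ‖ := lt_of_lt_of_le (by linarith [hr.2]) h4
      have hp : 0 < 1 - r ^ 2 := by nlinarith [hr.1, hr.2]
      have h6 : (1 - r ^ 2) / ‖1 - r * e θ‖ ≤ 2 := by
        rw [div_le_iff₀ hx]
        nlinarith [hr.1, hr.2]
      have hα1 : 0 ≤ α + 1 := by linarith
      gcongr
    · have hne : ∀ᵐ θ : ℝ, θ ≠ 2 * Real.pi := by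
        simp [MeasureTheory.ae_iff]
      filter_upwards [hne] with θ hθ2 hθ
      rw [Set.uIoc_of_le Real.two_pi_pos.le] at hθ
      have hlt : θ < 2 * Real.pi := lt_of_le_of_ne hθ.2 hθ2
      -- At an angle off the pole the bound tends to `0`, as the exponent `α + 1` is positive.
      have hx1 : (1 : ℂ) - ((1 : ℝ) : ℂ) * e θ ≠ 0 := by
        intro h0
        rw [Complex.ofReal_one, one_mul, sub_eq_zero, eq_comm, he, Complex.exp_eq_one_iff] at h0
        obtain ⟨n, hn⟩ := h0
        have h7 : (θ : ℂ) = ((n * (2 * Real.pi) : ℝ) : ℂ) := by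
          apply mul_right_cancel₀ Complex.I_ne_zero
          rw [hn]
          push_cast
          ring
        have h8 : θ = n * (2 * Real.pi) := Complex.ofReal_injective h7
        have h9 : (0 : ℝ) < n := by
          by_contra hcon
          nlinarith [hθ.1, Real.two_pi_pos]
        have h10 : (n : ℝ) < 1 := by
          by_contra hcon
          nlinarith [Real.two_pi_pos]
        have h11 : 0 < n := by exact_mod_cast h9
        have h12 : n < 1 := by exact_mod_cast h10
        omega
      have hT : Filter.Tendsto
          (fun r : ℝ => 2 * |(k : ℝ)| * ((1 - r ^ 2) / ‖1 - r * e θ‖) ^ (α + 1))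
          (nhds 1) (nhds (2 * |(k : ℝ)| *
            ((1 - (1 : ℝ) ^ 2) / ‖1 - ((1 : ℝ) : ℂ) * e θ‖) ^ (α + 1))) := by
        refine Filter.Tendsto.const_mul _ (Filter.Tendsto.rpow_const ?_ (Or.inr (by linarith)))
        refine Filter.Tendsto.div ?_ ?_ (norm_ne_zero_iff.2 hx1)
        · exact (by fun_prop : Continuous fun r : ℝ => 1 - r ^ 2).tendsto 1
        · exact (by fun_prop : Continuous fun r : ℝ => ‖1 - (r : ℂ) * e θ‖).tendsto 1
      rw [one_pow, sub_self, zero_div, Real.zero_rpow (by linarith), mul_zero] at hT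
      refine squeeze_zero_norm' ?_ (hT.mono_left nhdsWithin_le_nhds)
      filter_upwards [hIoo] with r hr using hbound r hr θ
  rw [intervalIntegral.integral_zero] at hlim
  have hlim2 := hlim.add_const (2 * Real.pi : ℂ)
  rw [zero_add] at hlim2
  refine hlim2.congr' ?_
  filter_upwards [hIoo] with r hr
  have h0 := hK.circleCoeff_zero hr
  have hK0 : alphaKernel α 0 = 1 := by simp [alphaKernel]
  -- The coefficient of index `0` is `2π` at every radius, by the mean value property.
  rw [hK0, mul_one] at h0
  have hi1 : Continuous fun θ : ℝ =>
      alphaKernel α (r * e θ) * (Complex.exp (-(k * θ * Complex.I)) - 1) :=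
    (hcont r hr).mul (by fun_prop)
  have hi2 : Continuous fun θ : ℝ => alphaKernel α (r * Complex.exp (θ * Complex.I)) *
      Complex.exp (-(((0 : ℤ) : ℂ) * θ * Complex.I)) :=
    (hcont r hr).mul (by fun_prop)
  rw [← h0, circleCoeff, circleCoeff, ← intervalIntegral.integral_add
    (hi1.intervalIntegrable _ _) (hi2.intervalIntegrable _ _)]
  refine intervalIntegral.integral_congr fun θ _ => ?_
  simp only [he, Int.cast_zero, zero_mul, neg_zero, Complex.exp_zero]
  ring

/-! ### The Poisson integral and its Fourier coefficients -/

/-- Completeness of the trigonometric system, for a continuous function on a circle. -/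
theorem eq_zero_of_circleCoeff_eq_zero {u : ℂ → ℂ} (hu : ContinuousOn u (Metric.ball (0 : ℂ) 1))
    {r : ℝ} (hr : r ∈ Set.Ioo (-1 : ℝ) 1) (h : ∀ k, circleCoeff u k r = 0) (θ : ℝ) :
    u (r * Complex.exp (θ * Complex.I)) = 0 := by
  have : Fact (0 < 2 * Real.pi) := ⟨Real.two_pi_pos⟩
  let v : C(AddCircle (2 * Real.pi), ℂ) :=
    ⟨fun x => u (r * (AddCircle.toCircle x : ℂ)), by
      rw [← continuousOn_univ]
      refine hu.comp ?_ fun x _ => ?_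
      · exact (continuous_const.mul
          (continuous_subtype_val.comp AddCircle.continuous_toCircle)).continuousOn
      · rw [mem_ball_zero_iff, norm_mul, Circle.norm_coe, mul_one, Complex.norm_real,
          Real.norm_eq_abs]
        exact abs_lt.2 hr⟩
  have hv : ∀ t : ℝ, v (t : AddCircle (2 * Real.pi)) = u (r * Complex.exp (t * Complex.I)) := by
    intro t
    change u (r * (AddCircle.toCircle (t : AddCircle (2 * Real.pi)) : ℂ)) = _
    rw [AddCircle.toCircle_apply_mk, div_self Real.two_pi_pos.ne', one_mul, Circle.coe_exp]
  have h0 : fourierCoeff v = 0 := by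
    funext k
    rw [fourierCoeff_eq_intervalIntegral _ _ 0, zero_add, Pi.zero_apply]
    refine smul_eq_zero_of_right _ ?_
    rw [← h k, circleCoeff]
    refine intervalIntegral.integral_congr fun t _ => ?_
    simp only [hv, fourier_coe_apply, smul_eq_mul]
    rw [mul_comm]
    congr 2
    have : (Real.pi : ℂ) ≠ 0 := Complex.ofReal_ne_zero.2 Real.pi_ne_zero
    push_cast
    field_simp
  have hs := has_pointwise_sum_fourier_series_of_summable (f := v) (by rw [h0]; exact summable_zero)
    (θ : AddCircle (2 * Real.pi))
  rw [h0] at hs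
  simp only [Pi.zero_apply, zero_smul] at hs
  rw [← hv, hs.unique hasSum_zero]

theorem Continuous.intervalIntegral_swap {G : ℝ → ℝ → ℂ} (hG : Continuous (Function.uncurry G))
    {a b : ℝ} (hab : a ≤ b) :
    ∫ x in a..b, ∫ y in a..b, G x y = ∫ y in a..b, ∫ x in a..b, G x y := by
  simp only [intervalIntegral.integral_of_le hab]
  refine MeasureTheory.integral_integral_swap ?_
  rw [MeasureTheory.Measure.prod_restrict]
  exact (hG.continuousOn.integrableOn_compact (isCompact_Icc.prod isCompact_Icc)).mono_set
    (Set.prod_mono Set.Ioc_subset_Icc_self Set.Ioc_subset_Icc_self)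

/-- The Poisson integral for the weighted Laplacian of a function `g` of the angle. -/
noncomputable def alphaPoisson (α : ℝ) (g : ℝ → ℂ) (z : ℂ) : ℂ :=
  (2 * Real.pi : ℂ)⁻¹ * ∫ φ in (0 : ℝ)..(2 * Real.pi),
    alphaKernel α (z * Complex.exp (-(φ * Complex.I))) * g φ

theorem norm_mul_exp_neg (z : ℂ) (φ : ℝ) : ‖z * Complex.exp (-(φ * Complex.I))‖ = ‖z‖ := by
  rw [norm_mul, ← conj_exp_mul_I, Complex.norm_conj, Complex.norm_exp_ofReal_mul_I, mul_one]

theorem mul_exp_neg_mem_ball {z : ℂ} (hz : z ∈ Metric.ball (0 : ℂ) 1) (φ : ℝ) :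
    z * Complex.exp (-(φ * Complex.I)) ∈ Metric.ball (0 : ℂ) 1 := by
  rw [mem_ball_zero_iff, norm_mul_exp_neg]
  exact mem_ball_zero_iff.1 hz

theorem continuousOn_alphaKernelZ (α : ℝ) :
    ContinuousOn (alphaKernelZ α) (Metric.ball (0 : ℂ) 1) :=
  ((contDiffOn_alphaKernel α).of_le (by norm_num)).continuousOn_wirtingerZ.congr fun _ hz =>
    (wirtingerZ_eq_of_hasFDerivAt (hasFDerivAt_alphaKernel α hz)).symm

theorem continuousOn_alphaKernelZBar (α : ℝ) :
    ContinuousOn (alphaKernelZBar α) (Metric.ball (0 : ℂ) 1) :=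
  ((contDiffOn_alphaKernel α).of_le (by norm_num)).continuousOn_wirtingerZBar.congr fun _ hz =>
    (wirtingerZBar_eq_of_hasFDerivAt (hasFDerivAt_alphaKernel α hz)).symm

theorem continuous_comp_rotation {u : ℂ → ℂ} (hu : ContinuousOn u (Metric.ball (0 : ℂ) 1)) {z : ℂ}
    (hz : z ∈ Metric.ball (0 : ℂ) 1) :
    Continuous fun φ : ℝ => u (z * Complex.exp (-(φ * Complex.I))) := by
  rw [← continuousOn_univ]
  exact hu.comp (by fun_prop) fun φ _ => mul_exp_neg_mem_ball hz φ

theorem hasFDerivAt_alphaKernel_rotation (α : ℝ) {z : ℂ} (hz : z ∈ Metric.ball (0 : ℂ) 1)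
    (φ : ℝ) (c : ℂ) :
    HasFDerivAt (fun w => alphaKernel α (w * Complex.exp (-(φ * Complex.I))) * c)
      (wirtingerCLM
        (alphaKernelZ α (z * Complex.exp (-(φ * Complex.I))) *
          (Complex.exp (-(φ * Complex.I)) * c))
        (alphaKernelZBar α (z * Complex.exp (-(φ * Complex.I))) *
          (Complex.exp (φ * Complex.I) * c))) z := by
  have h1 : HasFDerivAt (fun y : ℂ => y * Complex.exp (-(φ * Complex.I)))
      (wirtingerCLM (Complex.exp (-(φ * Complex.I))) 0) z := by
    refine ((hasFDerivAt_id z).mul_const _).congr_fderiv ?_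
    ext v
    simp [wirtingerCLM_apply]
  have h2 := ((hasFDerivAt_alphaKernel α (mul_exp_neg_mem_ball hz φ)).comp z h1).mul_const c
  refine h2.congr_fderiv ?_
  ext v
  have h3 : conj (Complex.exp (-(φ * Complex.I))) = Complex.exp (φ * Complex.I) := by
    rw [← conj_exp_mul_I, Complex.conj_conj]
  simp only [smul_apply, ContinuousLinearMap.comp_apply,
    wirtingerCLM_apply, smul_eq_mul, map_mul, h3, zero_mul, add_zero]
  ring

theorem intervalIntegral_wirtingerCLM {A B : ℝ → ℂ} (hA : Continuous A) (hB : Continuous B)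
    (a b : ℝ) :
    ∫ t in a..b, wirtingerCLM (A t) (B t) =
      wirtingerCLM (∫ t in a..b, A t) (∫ t in a..b, B t) := by
  have hW : Continuous fun t => wirtingerCLM (A t) (B t) :=
    continuous_wirtingerCLM.comp (hA.prodMk hB)
  ext v
  have hA' : Continuous fun t => A t * v := hA.mul continuous_const
  have hB' : Continuous fun t => B t * conj v := hB.mul continuous_const
  rw [ContinuousLinearMap.intervalIntegral_apply (hW.intervalIntegrable _ _)]
  simp only [wirtingerCLM_apply]
  rw [intervalIntegral.integral_add (hA'.intervalIntegrable _ _) (hB'.intervalIntegrable _ _),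
    intervalIntegral.integral_mul_const, intervalIntegral.integral_mul_const]

theorem hasFDerivAt_intervalIntegral_wirtinger {F A B : ℂ → ℝ → ℂ} {U : Set ℂ} (hU : IsOpen U)
    (hF : ∀ w ∈ U, Continuous (F w))
    (hA : ContinuousOn (Function.uncurry A) (U ×ˢ Set.univ))
    (hB : ContinuousOn (Function.uncurry B) (U ×ˢ Set.univ))
    (h : ∀ w ∈ U, ∀ t, HasFDerivAt (fun y => F y t) (wirtingerCLM (A w t) (B w t)) w) {z : ℂ}
    (hz : z ∈ U) (a b : ℝ) :
    HasFDerivAt (fun w => ∫ t in a..b, F w t)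
      (wirtingerCLM (∫ t in a..b, A z t) (∫ t in a..b, B z t)) z := by
  have hW : ContinuousOn (Function.uncurry fun w t => wirtingerCLM (A w t) (B w t))
      (U ×ˢ Set.univ) := continuous_wirtingerCLM.comp_continuousOn (hA.prodMk hB)
  have hs : ∀ {G : ℂ → ℝ → ℂ}, ContinuousOn (Function.uncurry G) (U ×ˢ Set.univ) →
      Continuous (G z) := fun hG => by
    rw [← continuousOn_univ]
    exact hG.comp (f := fun t : ℝ => (z, t)) (by fun_prop) (fun t _ => ⟨hz, trivial⟩)
  rw [← intervalIntegral_wirtingerCLM (hs hA) (hs hB)]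
  exact hasFDerivAt_intervalIntegral_of_continuousOn hU hF hW h hz a b

theorem continuousOn_comp_rotation_prod {u : ℂ → ℂ} (hu : ContinuousOn u (Metric.ball (0 : ℂ) 1)) :
    ContinuousOn (fun p : ℂ × ℝ => u (p.1 * Complex.exp (-(p.2 * Complex.I))))
      (Metric.ball (0 : ℂ) 1 ×ˢ Set.univ) :=
  hu.comp (by fun_prop) fun p hp => mul_exp_neg_mem_ball hp.1 p.2

theorem hasFDerivAt_alphaPoisson (α : ℝ) {g : ℝ → ℂ} (hg : Continuous g) {z : ℂ}
    (hz : z ∈ Metric.ball (0 : ℂ) 1) :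
    HasFDerivAt (alphaPoisson α g) (wirtingerCLM
      ((2 * Real.pi : ℂ)⁻¹ * ∫ φ in (0 : ℝ)..(2 * Real.pi),
        alphaKernelZ α (z * Complex.exp (-(φ * Complex.I))) *
          (Complex.exp (-(φ * Complex.I)) * g φ))
      ((2 * Real.pi : ℂ)⁻¹ * ∫ φ in (0 : ℝ)..(2 * Real.pi),
        alphaKernelZBar α (z * Complex.exp (-(φ * Complex.I))) *
          (Complex.exp (φ * Complex.I) * g φ))) z := by
  have h1 : ContinuousOn (fun p : ℂ × ℝ => Complex.exp (-(p.2 * Complex.I)) * g p.2)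
    (Metric.ball (0 : ℂ) 1 ×ˢ Set.univ) := by fun_prop
  have h2 : ContinuousOn (fun p : ℂ × ℝ => Complex.exp (p.2 * Complex.I) * g p.2)
    (Metric.ball (0 : ℂ) 1 ×ˢ Set.univ) := by fun_prop
  have key := hasFDerivAt_intervalIntegral_wirtinger Metric.isOpen_ball
    (F := fun w φ => alphaKernel α (w * Complex.exp (-(φ * Complex.I))) * g φ)
    (A := fun w φ => alphaKernelZ α (w * Complex.exp (-(φ * Complex.I))) *
      (Complex.exp (-(φ * Complex.I)) * g φ))
    (B := fun w φ => alphaKernelZBar α (w * Complex.exp (-(φ * Complex.I))) *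
      (Complex.exp (φ * Complex.I) * g φ))
    (fun w hw => (continuous_comp_rotation (contDiffOn_alphaKernel α).continuousOn hw).mul hg)
    ((continuousOn_comp_rotation_prod (continuousOn_alphaKernelZ α)).mul h1)
    ((continuousOn_comp_rotation_prod (continuousOn_alphaKernelZBar α)).mul h2)
    (fun w hw φ => hasFDerivAt_alphaKernel_rotation α hw φ (g φ)) hz 0 (2 * Real.pi)
  refine (key.const_mul ((2 * Real.pi : ℂ)⁻¹)).congr_fderiv ?_
  ext v
  rw [smul_apply, wirtingerCLM_apply, wirtingerCLM_apply, smul_eq_mul]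
  ring

theorem continuousOn_alphaPoisson (α : ℝ) {g : ℝ → ℂ} (hg : Continuous g) :
    ContinuousOn (alphaPoisson α g) (Metric.ball (0 : ℂ) 1) := fun _ hz =>
  (hasFDerivAt_alphaPoisson α hg hz).continuousAt.continuousWithinAt

/-- The Poisson integral is a convolution, so its Fourier coefficients are products. -/
theorem circleCoeff_alphaPoisson (α : ℝ) {g : ℝ → ℂ} (hg : Continuous g) (k : ℤ) {r : ℝ}
    (hr : r ∈ Set.Ioo (-1 : ℝ) 1) :
    circleCoeff (alphaPoisson α g) k r = (2 * Real.pi : ℂ)⁻¹ *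
      (∫ φ in (0 : ℝ)..(2 * Real.pi), g φ * Complex.exp (-(k * φ * Complex.I))) *
        circleCoeff (alphaKernel α) k r := by
  have hK := (contDiffOn_alphaKernel α).continuousOn
  have hcont : Continuous (Function.uncurry fun θ φ : ℝ =>
      alphaKernel α (r * Complex.exp (θ * Complex.I) * Complex.exp (-(φ * Complex.I))) * g φ *
        Complex.exp (-(k * θ * Complex.I))) := by
    have h1 : Continuous fun p : ℝ × ℝ => alphaKernel α
        (r * Complex.exp (p.1 * Complex.I) * Complex.exp (-(p.2 * Complex.I))) := by
      rw [← continuousOn_univ]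
      exact hK.comp (by fun_prop) fun p _ => mul_exp_neg_mem_ball (mul_exp_mem_ball hr p.1) p.2
    exact (h1.mul (by fun_prop)).mul (by fun_prop)
  set G : ℝ → ℂ := fun θ => alphaKernel α (r * Complex.exp (θ * Complex.I)) *
    Complex.exp (-(k * θ * Complex.I)) with hG
  have hper : Function.Periodic G (2 * Real.pi) := by
    intro θ
    have e1 : Complex.exp (((θ + 2 * Real.pi : ℝ) : ℂ) * Complex.I) =
        Complex.exp (θ * Complex.I) := by
      have := exp_int_mul_two_pi_I 1
      rw [Int.cast_one, one_mul] at this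
      rw [Complex.ofReal_add, add_mul, Complex.exp_add, this, mul_one]
    have e2 : Complex.exp (-(k * ((θ + 2 * Real.pi : ℝ) : ℂ) * Complex.I)) =
        Complex.exp (-(k * θ * Complex.I)) := by
      rw [Complex.ofReal_add, mul_add, add_mul, neg_add, Complex.exp_add,
        Complex.exp_neg (k * _ * _), Complex.exp_neg (k * ((2 * Real.pi : ℝ) : ℂ) * _), exp_int_mul_two_pi_I, inv_one, mul_one]
    simp only [hG, e1, e2]
  have hinner : ∀ φ : ℝ, ∫ θ in (0 : ℝ)..(2 * Real.pi),
      alphaKernel α (r * Complex.exp (θ * Complex.I) * Complex.exp (-(φ * Complex.I))) * g φ *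
        Complex.exp (-(k * θ * Complex.I)) =
      g φ * Complex.exp (-(k * φ * Complex.I)) * circleCoeff (alphaKernel α) k r := by
    intro φ
    have h1 : ∫ θ in (0 : ℝ)..(2 * Real.pi), G (θ - φ) = circleCoeff (alphaKernel α) k r := by
      rw [intervalIntegral.integral_comp_sub_right]
      have := hper.intervalIntegral_add_eq (0 - φ) 0
      rw [zero_add, show 0 - φ + 2 * Real.pi = 2 * Real.pi - φ by ring] at this
      rw [this, circleCoeff]
    rw [← h1, ← intervalIntegral.integral_const_mul]
    refine intervalIntegral.integral_congr fun θ _ => ?_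
    have e1 : Complex.exp (((θ - φ : ℝ) : ℂ) * Complex.I) =
        Complex.exp (θ * Complex.I) * Complex.exp (-(φ * Complex.I)) := by
      rw [← Complex.exp_add]; push_cast; ring_nf
    have e2 : Complex.exp (-(k * φ * Complex.I)) *
        Complex.exp (-(k * ((θ - φ : ℝ) : ℂ) * Complex.I)) =
        Complex.exp (-(k * θ * Complex.I)) := by
      rw [← Complex.exp_add]; push_cast; ring_nf
    simp only [hG, e1]
    rw [← e2]
    ring_nf
  calc circleCoeff (alphaPoisson α g) k r
      = ∫ θ in (0 : ℝ)..(2 * Real.pi), (2 * Real.pi : ℂ)⁻¹ * ∫ φ in (0 : ℝ)..(2 * Real.pi),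
          alphaKernel α (r * Complex.exp (θ * Complex.I) * Complex.exp (-(φ * Complex.I))) * g φ *
            Complex.exp (-(k * θ * Complex.I)) := by
        refine intervalIntegral.integral_congr fun θ _ => ?_
        simp only [alphaPoisson]
        rw [intervalIntegral.integral_mul_const, mul_assoc]
    _ = _ := by
        rw [intervalIntegral.integral_const_mul, hcont.intervalIntegral_swap Real.two_pi_pos.le]
        simp only [hinner]
        rw [intervalIntegral.integral_mul_const, mul_assoc]

/-- An `α`-harmonic function is the Poisson integral of its boundary value: on every circle the
two functions have the same Fourier coefficients, since these are determined up to a factor by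
the radial equation, and the factor by the limit at radius `1`. -/
theorem IsAlphaHarmonic.eq_alphaPoisson {α : ℝ} (hα : -1 < α) {f : ℂ → ℂ}
    (hf : IsAlphaHarmonic α f) {g : Circle → ℂ} (hg : Continuous g)
    (hbd : HasDistributionalBoundaryValue f g) {z : ℂ} (hz : z ∈ Metric.ball (0 : ℂ) 1) :
    f z = alphaPoisson α (fun φ => g (Circle.exp φ)) z := by
  have hg' : Continuous fun φ : ℝ => g (Circle.exp φ) := hg.comp Circle.exp.continuous
  have hK := isAlphaHarmonic_alphaKernel α
  have hIoo : Set.Ioo (0 : ℝ) 1 ∈ nhdsWithin (1 : ℝ) (Set.Iio 1) := Ioo_mem_nhdsLT one_pos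
  have hpi : (2 * Real.pi : ℂ) ≠ 0 := by
    exact_mod_cast Real.two_pi_pos.ne'
  have hcoeff : ∀ k : ℤ, ∀ r ∈ Set.Ioo (0 : ℝ) 1, circleCoeff f k r =
      circleCoeff (alphaPoisson α fun φ => g (Circle.exp φ)) k r := by
    intro k r hr
    have hlimK := tendsto_circleCoeff_alphaKernel hα k
    obtain ⟨s, hs, hsne⟩ := ((hlimK.eventually_ne hpi).and hIoo).exists
    obtain ⟨c, hc⟩ := hf.exists_circleCoeff_eq_mul hK k ⟨s, hsne, hs⟩
    have hlim := hbd (fun θ => Complex.exp (-(k * θ * Complex.I)))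
      (by
        have : ContDiff ℝ ∞ fun θ : ℝ => (θ : ℂ) := Complex.ofRealCLM.contDiff
        fun_prop)
      (fun θ => by
        simp only
        rw [Complex.ofReal_add, mul_add, add_mul, neg_add, Complex.exp_add,
          Complex.exp_neg (k * _ * _), Complex.exp_neg (k * ((2 * Real.pi : ℝ) : ℂ) * _),
          exp_int_mul_two_pi_I, inv_one, mul_one])
    have hlim2 := hlimK.const_mul c
    have hcval := tendsto_nhds_unique (hlim2.congr' (by
      filter_upwards [hIoo] with r hr
      rw [← hc r hr, circleCoeff]
      simp only [Circle.coe_exp])) hlim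
    rw [circleCoeff_alphaPoisson α hg' k (Set.Ioo_subset_Ioo_left (by norm_num) hr), hc r hr,
      ← hcval]
    field_simp
  rcases eq_or_ne z 0 with rfl | hz0
  · have hhalf : (1 / 2 : ℝ) ∈ Set.Ioo (0 : ℝ) 1 := by norm_num
    have h1 := hcoeff 0 (1 / 2) hhalf
    rw [circleCoeff_alphaPoisson α hg' 0 (by norm_num), hf.circleCoeff_zero hhalf,
      hK.circleCoeff_zero hhalf] at h1
    have hK0 : alphaKernel α 0 = 1 := by simp [alphaKernel]
    simp only [hK0, Int.cast_zero, zero_mul, neg_zero, Complex.exp_zero, mul_one] at h1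
    simp only [alphaPoisson, zero_mul, hK0, one_mul]
    apply mul_left_cancel₀ hpi
    rw [h1]
    ring
  · have hr : ‖z‖ ∈ Set.Ioo (0 : ℝ) 1 := ⟨norm_pos_iff.2 hz0, mem_ball_zero_iff.1 hz⟩
    have hr' := Set.Ioo_subset_Ioo_left (show (-1 : ℝ) ≤ 0 by norm_num) hr
    have hcf := hf.contDiffOn.continuousOn
    have hcF := continuousOn_alphaPoisson α hg'
    have h1 := eq_zero_of_circleCoeff_eq_zero (hcf.sub hcF) hr' (fun k => by
      have := hcoeff k ‖z‖ hr
      have hi : ∀ {u : ℂ → ℂ}, ContinuousOn u (Metric.ball (0 : ℂ) 1) → IntervalIntegrable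
          (fun θ : ℝ => u (‖z‖ * Complex.exp (θ * Complex.I)) *
            Complex.exp (-(k * θ * Complex.I))) MeasureTheory.volume 0 (2 * Real.pi) :=
        fun hu => Continuous.intervalIntegrable
          ((continuous_comp_circle hu hr').mul (by fun_prop)) _ _
      rw [← sub_eq_zero, circleCoeff, circleCoeff,
        ← intervalIntegral.integral_sub (hi hcf) (hi hcF)] at this
      rw [← this]
      refine intervalIntegral.integral_congr fun θ _ => ?_
      simp only [Pi.sub_apply]
      ring) z.arg
    rw [Complex.norm_mul_exp_arg_mul_I] at h1
    exact sub_eq_zero.1 h1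

/-! ### The mean modulus of the kernel -/

theorem norm_one_add_pos {r : ℝ} (hr : r ∈ Set.Ico (0 : ℝ) 1) (θ : ℝ) :
    0 < ‖1 + (r : ℂ) * Complex.exp (θ * Complex.I)‖ := by
  have h := norm_sub_norm_le 1 (-((r : ℂ) * Complex.exp (θ * Complex.I)))
  rw [norm_neg, norm_ofReal_mul_exp, abs_of_nonneg hr.1, norm_one, sub_neg_eq_add] at h
  linarith [hr.2]

/-- The Möbius change of variables `e^{iφ} = (e^{iθ} - r) / (1 - r e^{iθ})` of the circle: its
derivative is the classical Poisson kernel, and `1 + r e^{iφ} = (1 - r²) / (1 - r e^{iθ})`. -/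
theorem integral_norm_one_add_rpow {r : ℝ} (hr : r ∈ Set.Ico (0 : ℝ) 1) (α : ℝ) :
    ∫ φ in (0 : ℝ)..(2 * Real.pi), ‖1 + (r : ℂ) * Complex.exp (φ * Complex.I)‖ ^ α =
      ∫ θ in (0 : ℝ)..(2 * Real.pi), (1 - r ^ 2) ^ (α + 1) *
        ‖1 - (r : ℂ) * Complex.exp (θ * Complex.I)‖ ^ (-(α + 2)) := by
  have hr' : r ∈ Set.Ioo (-1 : ℝ) 1 := ⟨by linarith [hr.1], hr.2⟩
  set w : ℝ → ℂ := fun θ => 1 - (r : ℂ) * Complex.exp (θ * Complex.I) with hw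
  have hws : ∀ θ, w θ ∈ Complex.slitPlane := fun θ =>
    one_sub_mem_slitPlane (mul_exp_mem_ball hr' θ)
  have hw0 : ∀ θ, w θ ≠ 0 := fun θ => Complex.slitPlane_ne_zero (hws θ)
  have hpos : 0 < 1 - r ^ 2 := by nlinarith [hr.1, hr.2]
  -- The angle of `(e^{iθ} - r) / (1 - r e^{iθ})`, chosen so that `0` and `2π` are fixed.
  set Φ : ℝ → ℝ := fun θ => θ - 2 * (Complex.log (w θ)).im with hΦ
  have hwd : ∀ θ : ℝ,
      HasDerivAt w (-(r * (Complex.I * Complex.exp (θ * Complex.I)))) θ := fun θ => by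
    have h := ((hasDerivAt_exp_mul_I 1 θ).const_mul (r : ℂ)).const_sub 1
    simpa only [one_mul] using h
  have hnsq : ∀ θ, ‖1 - w θ‖ ^ 2 = r ^ 2 := fun θ => by
    rw [hw]
    simp only [sub_sub_cancel]
    rw [norm_ofReal_mul_exp, sq_abs]
  have hder : ∀ θ, HasDerivAt Φ ((1 - r ^ 2) / ‖w θ‖ ^ 2) θ := fun θ => by
    have h1 := Complex.imCLM.hasFDerivAt.comp_hasDerivAt θ ((hwd θ).clog_real (hws θ))
    refine ((hasDerivAt_id θ).sub (h1.const_mul 2)).congr_deriv ?_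
    have h2 : -(r * (Complex.I * Complex.exp (θ * Complex.I))) / w θ =
        Complex.I - Complex.I * (w θ)⁻¹ := by
      have h3 : (r : ℂ) * Complex.exp (θ * Complex.I) = 1 - w θ := by simp [hw]
      rw [mul_left_comm, h3, ← div_eq_mul_inv]
      field_simp [hw0 θ]
      ring
    rw [h2, Complex.imCLM_apply, Complex.sub_im, Complex.I_im, Complex.I_mul_im, Complex.inv_re,
      ← Complex.normSq_eq_norm_sq]
    have h4 : Complex.normSq (w θ) ≠ 0 := (Complex.normSq_pos.2 (hw0 θ)).ne'
    have h5 := hnsq θ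
    rw [← Complex.normSq_eq_norm_sq, Complex.normSq_sub, Complex.normSq_one, one_mul,
      Complex.conj_re] at h5
    field_simp
    linarith
  have hexp : ∀ θ, 1 + (r : ℂ) * Complex.exp (Φ θ * Complex.I) = ((1 - r ^ 2 : ℝ) : ℂ) / w θ := by
    intro θ
    have h1 : Complex.exp (Φ θ * Complex.I) =
        Complex.exp (θ * Complex.I) * (conj (w θ) / w θ) := by
      have h2 : (Φ θ : ℂ) * Complex.I =
          θ * Complex.I + (conj (Complex.log (w θ)) - Complex.log (w θ)) := by
        apply Complex.ext <;> simp [hΦ]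
        ring
      rw [h2, Complex.exp_add, Complex.exp_sub, Complex.exp_conj, Complex.exp_log (hw0 θ)]
    have h3 : conj (w θ) = 1 - r * Complex.exp (-(θ * Complex.I)) := by
      simp only [hw, map_sub, map_one, map_mul, Complex.conj_ofReal, conj_exp_mul_I]
    have h4 : Complex.exp (θ * Complex.I) * Complex.exp (-(θ * Complex.I)) = 1 := by
      rw [← Complex.exp_add, add_neg_cancel, Complex.exp_zero]
    rw [h1, h3, eq_div_iff (hw0 θ), add_mul, mul_assoc, mul_assoc, div_mul_cancel₀ _ (hw0 θ)]
    simp only [hw]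
    push_cast
    linear_combination (-(r : ℂ) ^ 2) * h4
  have h0 : Φ 0 = 0 := by
    have : w 0 = ((1 - r : ℝ) : ℂ) := by simp [hw]
    simp only [hΦ]
    rw [this, ← Complex.ofReal_log (by linarith [hr.2]), Complex.ofReal_im]
    ring
  have h2π : Φ (2 * Real.pi) = 2 * Real.pi := by
    have h1 := exp_int_mul_two_pi_I 1
    rw [Int.cast_one, one_mul] at h1
    have : w (2 * Real.pi) = ((1 - r : ℝ) : ℂ) := by
      simp only [hw]
      rw [h1]
      simp
    simp only [hΦ]
    rw [this, ← Complex.ofReal_log (by linarith [hr.2]), Complex.ofReal_im]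
    ring
  have hwc : Continuous w := by rw [hw]; fun_prop
  have hsub := intervalIntegral.integral_comp_mul_deriv (a := 0) (b := 2 * Real.pi)
    (f := Φ) (g := fun φ : ℝ => ‖1 + (r : ℂ) * Complex.exp (φ * Complex.I)‖ ^ α)
    (fun θ _ => hder θ)
    (continuous_const.div (hwc.norm.pow 2)
      fun θ => pow_ne_zero 2 (norm_ne_zero_iff.2 (hw0 θ))).continuousOn
    ((by fun_prop : Continuous fun φ : ℝ => ‖1 + (r : ℂ) * Complex.exp (φ * Complex.I)‖).rpow_const
      fun φ => Or.inl (norm_one_add_pos hr φ).ne')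
  rw [h0, h2π] at hsub
  rw [← hsub]
  refine intervalIntegral.integral_congr fun θ _ => ?_
  have hwp : 0 < ‖w θ‖ := norm_pos_iff.2 (hw0 θ)
  simp only [Function.comp_apply, hexp]
  rw [norm_div, Complex.norm_real, Real.norm_of_nonneg hpos.le, Real.div_rpow hpos.le hwp.le,
    Real.rpow_add_one hpos.ne', Real.rpow_neg hwp.le, Real.rpow_add hwp, Real.rpow_two]
  field_simp

theorem integral_exp_int_mul_I (k : ℤ) :
    ∫ θ in (0 : ℝ)..(2 * Real.pi), Complex.exp (k * θ * Complex.I) =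
      if k = 0 then (2 * Real.pi : ℂ) else 0 := by
  split_ifs with h
  · simp [h]
  · have hk : (k : ℂ) * Complex.I ≠ 0 := mul_ne_zero (Int.cast_ne_zero.2 h) Complex.I_ne_zero
    have h1 := integral_exp_mul_complex (a := 0) (b := 2 * Real.pi) hk
    have h2 := exp_int_mul_two_pi_I k
    rw [mul_right_comm] at h2
    rw [h2] at h1
    simp only [Complex.ofReal_zero, mul_zero, Complex.exp_zero, sub_self, zero_div] at h1
    rw [← h1]
    refine intervalIntegral.integral_congr fun θ _ => ?_
    ring_nf

/-- A power series may be integrated termwise over a circle against a continuous weight. -/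
theorem hasSum_integral_circle_mul {a : ℕ → ℝ} {h : ℂ → ℂ}
    (hh : ∀ z ∈ Metric.ball (0 : ℂ) 1, HasSum (fun n => (a n : ℂ) * z ^ n) (h z)) {r : ℝ}
    (hr : r ∈ Set.Ico (0 : ℝ) 1) {ψ : ℝ → ℂ} (hψ : Continuous ψ) :
    HasSum (fun n : ℕ => (a n : ℂ) * (r : ℂ) ^ n *
        ∫ θ in (0 : ℝ)..(2 * Real.pi), Complex.exp (n * θ * Complex.I) * ψ θ)
      (∫ θ in (0 : ℝ)..(2 * Real.pi), h (r * Complex.exp (θ * Complex.I)) * ψ θ) := by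
  have hr' : r ∈ Set.Ioo (-1 : ℝ) 1 := ⟨by linarith [hr.1], hr.2⟩
  have hsum : Summable fun n => |a n| * r ^ n := by
    have h1 := (hh r (by simpa [abs_of_nonneg hr.1] using hr.2)).summable.norm
    simpa [abs_of_nonneg hr.1] using h1
  have hterm : ∀ (n : ℕ) (θ : ℝ), (a n : ℂ) * (r * Complex.exp (θ * Complex.I)) ^ n * ψ θ =
      (a n : ℂ) * (r : ℂ) ^ n * (Complex.exp (n * θ * Complex.I) * ψ θ) := fun n θ => by
    rw [mul_pow, ← Complex.exp_nat_mul]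
    ring_nf
  have key := intervalIntegral.hasSum_integral_of_dominated_convergence
    (μ := MeasureTheory.volume) (a := 0) (b := 2 * Real.pi)
    (F := fun n θ => (a n : ℂ) * (r * Complex.exp (θ * Complex.I)) ^ n * ψ θ)
    (f := fun θ => h (r * Complex.exp (θ * Complex.I)) * ψ θ)
    (fun n θ => |a n| * r ^ n * ‖ψ θ‖)
    (fun n => (by fun_prop : Continuous fun θ : ℝ =>
      (a n : ℂ) * (r * Complex.exp (θ * Complex.I)) ^ n * ψ θ).aestronglyMeasurable)
    (fun n => .of_forall fun θ _ => by
      rw [norm_mul, norm_mul, norm_pow, norm_ofReal_mul_exp, abs_of_nonneg hr.1, Complex.norm_real,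
        Real.norm_eq_abs])
    (.of_forall fun θ _ => hsum.mul_right _)
    (by
      simp only [tsum_mul_right]
      exact (continuous_const.mul hψ.norm).intervalIntegrable _ _)
    (.of_forall fun θ _ => (hh _ (mul_exp_mem_ball hr' θ)).mul_right _)
  simp only [hterm, intervalIntegral.integral_const_mul] at key
  exact key

/-- Parseval's identity for a power series with real coefficients. -/
theorem hasSum_integral_norm_sq {a : ℕ → ℝ} {h : ℂ → ℂ}
    (hh : ∀ z ∈ Metric.ball (0 : ℂ) 1, HasSum (fun n => (a n : ℂ) * z ^ n) (h z))
    (hc : ContinuousOn h (Metric.ball (0 : ℂ) 1)) {r : ℝ} (hr : r ∈ Set.Ico (0 : ℝ) 1) :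
    HasSum (fun n : ℕ => 2 * Real.pi * (a n ^ 2 * (r ^ 2) ^ n))
      (∫ θ in (0 : ℝ)..(2 * Real.pi), ‖h (r * Complex.exp (θ * Complex.I))‖ ^ 2) := by
  have hr' : r ∈ Set.Ioo (-1 : ℝ) 1 := ⟨by linarith [hr.1], hr.2⟩
  have hcont := continuous_comp_circle hc hr'
  have hcoef : ∀ n : ℕ, ∫ θ in (0 : ℝ)..(2 * Real.pi), h (r * Complex.exp (θ * Complex.I)) *
      Complex.exp (-(n * θ * Complex.I)) = 2 * Real.pi * (a n * (r : ℂ) ^ n) := by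
    intro n
    have h1 := hasSum_integral_circle_mul hh hr
      (ψ := fun θ => Complex.exp (-(n * θ * Complex.I))) (by fun_prop)
    have h2 : ∀ m : ℕ, ∫ θ in (0 : ℝ)..(2 * Real.pi), Complex.exp (m * θ * Complex.I) *
        Complex.exp (-(n * θ * Complex.I)) = if m = n then (2 * Real.pi : ℂ) else 0 := by
      intro m
      have h3 := integral_exp_int_mul_I (m - n)
      simp only [sub_eq_zero, Nat.cast_inj] at h3
      rw [← h3]
      refine intervalIntegral.integral_congr fun θ _ => ?_
      rw [← Complex.exp_add]
      push_cast
      ring_nf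
    simp only [h2] at h1
    have h4 := hasSum_single (f := fun m : ℕ =>
      (a m : ℂ) * (r : ℂ) ^ m * if m = n then (2 * Real.pi : ℂ) else 0) n
      (fun m hm => by simp [hm])
    rw [h1.unique h4, if_pos rfl]
    ring
  -- Termwise integration against `conj h` brings in the conjugates of the same coefficients.
  have h5 := hasSum_integral_circle_mul hh hr
    (ψ := fun θ => conj (h (r * Complex.exp (θ * Complex.I)))) (Complex.continuous_conj.comp hcont)
  have h6 : ∀ n : ℕ, ∫ θ in (0 : ℝ)..(2 * Real.pi), Complex.exp (n * θ * Complex.I) *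
      conj (h (r * Complex.exp (θ * Complex.I))) = 2 * Real.pi * (a n * (r : ℂ) ^ n) := by
    intro n
    have h7 := congrArg conj (hcoef n)
    rw [← intervalIntegral.intervalIntegral_conj] at h7
    simp only [map_mul, map_pow, Complex.conj_ofReal, map_ofNat] at h7
    rw [← h7]
    refine intervalIntegral.integral_congr fun θ _ => ?_
    rw [mul_comm, ← Complex.exp_conj]
    simp
  simp only [h6, Complex.mul_conj'] at h5
  rw [← Complex.hasSum_ofReal, ← intervalIntegral.integral_ofReal]
  push_cast
  convert h5 using 2
  ring

/-- The squares of the binomial coefficients of exponent `a` are the coefficients of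
`₂F₁(-a, -a; 1; x)`. -/
theorem choose_sq_eq (a : ℝ) (n : ℕ) :
    Ring.choose a n ^ 2 = (n.factorial : ℝ)⁻¹ * (ascPochhammer ℝ n).eval (-a) *
      (ascPochhammer ℝ n).eval (-a) * ((ascPochhammer ℝ n).eval 1)⁻¹ := by
  have hn : (n.factorial : ℝ) ≠ 0 := Nat.cast_ne_zero.2 n.factorial_ne_zero
  have h1 := Ring.choose_neg (-a) n
  rw [neg_neg, ← Ring.multichoose_eq] at h1
  have h2 := Ring.factorial_nsmul_multichoose_eq_ascPochhammer (-a) n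
  rw [Polynomial.ascPochhammer_smeval_eq_eval, nsmul_eq_mul] at h2
  rw [ascPochhammer_eval_one, ← h2, h1]
  rcases Int.even_or_odd n with he | ho
  · rw [Int.negOnePow_even _ he, one_smul]
    field_simp
  · rw [Int.negOnePow_odd _ ho, Units.neg_smul, one_smul]
    field_simp

/-- The mean of the modulus of the kernel over a circle. After the Möbius change of variables it
is the mean of `|1 + r e^{iφ}|^α`, the squared modulus of a binomial series. -/
theorem integral_norm_alphaKernel (α : ℝ) {r : ℝ} (hr : r ∈ Set.Ico (0 : ℝ) 1) :
    ∫ θ in (0 : ℝ)..(2 * Real.pi), ‖alphaKernel α (r * Complex.exp (θ * Complex.I))‖ =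
      2 * Real.pi * ordinaryHypergeometric (-α / 2) (-α / 2) (1 : ℝ) (r ^ 2 : ℝ) := by
  have hr' : r ∈ Set.Ioo (-1 : ℝ) 1 := ⟨by linarith [hr.1], hr.2⟩
  have hslit : ∀ z ∈ Metric.ball (0 : ℂ) 1, 1 + z ∈ Complex.slitPlane := fun z hz => by
    have := one_sub_mem_slitPlane (z := -z) (by simpa using hz)
    rwa [sub_neg_eq_add] at this
  have hsum : ∀ z ∈ Metric.ball (0 : ℂ) 1, HasSum
      (fun n => ((Ring.choose (α / 2) n : ℝ) : ℂ) * z ^ n) ((1 + z) ^ ((α / 2 : ℝ) : ℂ)) := by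
    intro z hz
    have h1 := (Complex.one_add_cpow_hasFPowerSeriesOnBall_zero (a := ((α / 2 : ℝ) : ℂ))).hasSum
      (y := z) (by simpa [← ofReal_norm, ENNReal.ofReal_lt_one] using hz)
    rw [zero_add] at h1
    have h2 : ∀ n, binomialSeries ℂ ((α / 2 : ℝ) : ℂ) n (fun _ => z) =
        ((Ring.choose (α / 2) n : ℝ) : ℂ) * z ^ n := fun n => by
      rw [binomialSeries_apply, Complex.ofReal_choose]
      simp
    simpa only [h2] using h1
  have hcont : ContinuousOn (fun z : ℂ => (1 + z) ^ ((α / 2 : ℝ) : ℂ)) (Metric.ball (0 : ℂ) 1) :=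
    (continuousOn_const.add continuousOn_id).cpow_const fun z hz => hslit z hz
  have h2 := hasSum_integral_norm_sq hsum hcont hr
  have h3 : ∫ θ in (0 : ℝ)..(2 * Real.pi),
      ‖(1 + (r : ℂ) * Complex.exp (θ * Complex.I)) ^ ((α / 2 : ℝ) : ℂ)‖ ^ 2 =
      ∫ θ in (0 : ℝ)..(2 * Real.pi), ‖alphaKernel α (r * Complex.exp (θ * Complex.I))‖ := by
    have h4 : ∀ θ : ℝ, ‖(1 + (r : ℂ) * Complex.exp (θ * Complex.I)) ^ ((α / 2 : ℝ) : ℂ)‖ ^ 2 =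
        ‖1 + (r : ℂ) * Complex.exp (θ * Complex.I)‖ ^ α := fun θ => by
      rw [Complex.norm_cpow_real, ← Real.rpow_natCast, ← Real.rpow_mul (norm_nonneg _)]
      congr 1
      push_cast
      ring
    simp only [h4]
    rw [integral_norm_one_add_rpow hr]
    refine intervalIntegral.integral_congr fun θ _ => ?_
    rw [norm_alphaKernel α (mul_exp_mem_ball hr' θ), norm_ofReal_mul_exp, sq_abs]
  rw [← h3, ← h2.tsum_eq, tsum_mul_left, ordinaryHypergeometric_eq_tsum]
  congr 1
  refine tsum_congr fun n => ?_
  rw [choose_sq_eq, smul_eq_mul, neg_div]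

/-! ### The estimate -/

theorem norm_alphaKernel_conj (α : ℝ) {z : ℂ} (hz : z ∈ Metric.ball (0 : ℂ) 1) :
    ‖alphaKernel α (conj z)‖ = ‖alphaKernel α z‖ := by
  have h2 : ‖1 - conj z‖ = ‖1 - z‖ := by
    rw [← Complex.norm_conj (1 - z), map_sub, map_one]
  rw [norm_alphaKernel α (conj_mem_ball hz), norm_alphaKernel α hz, Complex.norm_conj, h2]

theorem integral_norm_alphaKernel_rotation (α : ℝ) {z : ℂ} (hz : z ∈ Metric.ball (0 : ℂ) 1) :
    ∫ φ in (0 : ℝ)..(2 * Real.pi), ‖alphaKernel α (z * Complex.exp (-(φ * Complex.I)))‖ =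
      2 * Real.pi * ordinaryHypergeometric (-α / 2) (-α / 2) (1 : ℝ) (‖z‖ ^ 2 : ℝ) := by
  set G : ℝ → ℝ := fun θ => ‖alphaKernel α (‖z‖ * Complex.exp (θ * Complex.I))‖ with hG
  have hper : Function.Periodic G (2 * Real.pi) := fun θ => by
    have h := exp_int_mul_two_pi_I 1
    rw [Int.cast_one, one_mul] at h
    simp only [hG]
    rw [Complex.ofReal_add, add_mul, Complex.exp_add, h, mul_one]
  have h1 : ∀ φ : ℝ, ‖alphaKernel α (z * Complex.exp (-(φ * Complex.I)))‖ = G (φ - z.arg) := by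
    intro φ
    rw [← norm_alphaKernel_conj α (mul_exp_neg_mem_ball hz φ)]
    simp only [hG]
    congr 2
    conv_lhs => rw [← Complex.norm_mul_exp_arg_mul_I z]
    rw [map_mul, map_mul, Complex.conj_ofReal, conj_exp_mul_I, ← conj_exp_mul_I φ,
      Complex.conj_conj, mul_assoc, ← Complex.exp_add]
    push_cast
    ring_nf
  simp only [h1]
  rw [intervalIntegral.integral_comp_sub_right]
  have h2 := hper.intervalIntegral_add_eq (0 - z.arg) 0
  rw [zero_add, show 0 - z.arg + 2 * Real.pi = 2 * Real.pi - z.arg by ring] at h2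
  rw [h2]
  exact integral_norm_alphaKernel α ⟨norm_nonneg z, mem_ball_zero_iff.1 hz⟩

/-- Both Wirtinger derivatives of the Poisson integral are estimated under the integral sign. -/
theorem normD_alphaPoisson_le {α : ℝ} (hα : -1 < α) {g : ℝ → ℂ} (hg : Continuous g) {M : ℝ}
    (hM : ∀ φ, ‖g φ‖ ≤ M) {z : ℂ} (hz : z ∈ Metric.ball (0 : ℂ) 1) :
    normD (alphaPoisson α g) z ≤ (2 + α + |α|) * M / (1 - ‖z‖ ^ 2) *
      ordinaryHypergeometric (-α / 2) (-α / 2) (1 : ℝ) (‖z‖ ^ 2 : ℝ) := by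
  have hd := hasFDerivAt_alphaPoisson α hg hz
  have hp := one_sub_norm_sq_pos hz
  have hM0 : 0 ≤ M := (norm_nonneg _).trans (hM 0)
  have hpi : ‖(2 * Real.pi : ℂ)⁻¹‖ = (2 * Real.pi)⁻¹ := by
    rw [norm_inv, norm_mul, Complex.norm_real, Real.norm_of_nonneg Real.pi_pos.le]
    norm_num
  have hKc : Continuous fun φ : ℝ => ‖alphaKernel α (z * Complex.exp (-(φ * Complex.I)))‖ :=
    (continuous_comp_rotation (contDiffOn_alphaKernel α).continuousOn hz).norm
  have hint : ∀ (C : ℝ) (v : ℝ → ℂ), (∀ φ, ‖v φ‖ ≤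
      C / (1 - ‖z‖ ^ 2) * ‖alphaKernel α (z * Complex.exp (-(φ * Complex.I)))‖ * M) →
      ‖(2 * Real.pi : ℂ)⁻¹ * ∫ φ in (0 : ℝ)..(2 * Real.pi), v φ‖ ≤ C * M / (1 - ‖z‖ ^ 2) *
        ordinaryHypergeometric (-α / 2) (-α / 2) (1 : ℝ) (‖z‖ ^ 2 : ℝ) := by
    intro C v hv
    have h1 : ‖∫ φ in (0 : ℝ)..(2 * Real.pi), v φ‖ ≤ ∫ φ in (0 : ℝ)..(2 * Real.pi),
        C / (1 - ‖z‖ ^ 2) * ‖alphaKernel α (z * Complex.exp (-(φ * Complex.I)))‖ * M :=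
      intervalIntegral.norm_integral_le_of_norm_le Real.two_pi_pos.le
        (.of_forall fun φ _ => hv φ)
        (((continuous_const.mul hKc).mul continuous_const).intervalIntegrable _ _)
    rw [intervalIntegral.integral_mul_const, intervalIntegral.integral_const_mul,
      integral_norm_alphaKernel_rotation α hz] at h1
    rw [norm_mul, hpi]
    refine (mul_le_mul_of_nonneg_left h1 (inv_nonneg.2 Real.two_pi_pos.le)).trans_eq ?_
    have := Real.pi_ne_zero
    field_simp
  have hexp : ∀ φ : ℝ, ‖Complex.exp (-(φ * Complex.I))‖ = 1 := fun φ => by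
    rw [← conj_exp_mul_I, Complex.norm_conj, Complex.norm_exp_ofReal_mul_I]
  rw [normD, wirtingerZ_eq_of_hasFDerivAt hd, wirtingerZBar_eq_of_hasFDerivAt hd]
  have hZ := hint (1 + |α|) _ fun φ => by
    have h1 := norm_alphaKernelZ_le α (mul_exp_neg_mem_ball hz φ)
    rw [norm_mul_exp_neg] at h1
    calc ‖alphaKernelZ α (z * Complex.exp (-(φ * Complex.I))) *
          (Complex.exp (-(φ * Complex.I)) * g φ)‖
        = ‖alphaKernelZ α (z * Complex.exp (-(φ * Complex.I)))‖ * ‖g φ‖ := by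
          rw [norm_mul, norm_mul, hexp, one_mul]
      _ ≤ _ := mul_le_mul h1 (hM φ) (norm_nonneg _) (by positivity)
  have hB := hint (1 + α) _ fun φ => by
    have h1 := (norm_alphaKernelZBar hα (mul_exp_neg_mem_ball hz φ)).le
    rw [norm_mul_exp_neg] at h1
    calc ‖alphaKernelZBar α (z * Complex.exp (-(φ * Complex.I))) *
          (Complex.exp (φ * Complex.I) * g φ)‖
        = ‖alphaKernelZBar α (z * Complex.exp (-(φ * Complex.I)))‖ * ‖g φ‖ := by
          rw [norm_mul, norm_mul, Complex.norm_exp_ofReal_mul_I, one_mul]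
      _ ≤ _ := mul_le_mul h1 (hM φ) (norm_nonneg _)
          (mul_nonneg (div_nonneg (by linarith) hp.le) (norm_nonneg _))
  refine (add_le_add hZ hB).trans_eq ?_
  ring

/-- The two cases of the estimate in one formula. -/
theorem IsAlphaHarmonic.normD_le {α : ℝ} (hα : -1 < α) {f : ℂ → ℂ} (hf : IsAlphaHarmonic α f)
    (fstar : C(Circle, ℂ)) (hbd : HasDistributionalBoundaryValue f fstar) {z : ℂ}
    (hz : z ∈ Metric.ball (0 : ℂ) 1) :
    normD f z ≤ (2 + α + |α|) * ‖fstar‖ / (1 - ‖z‖ ^ 2) *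
      ordinaryHypergeometric (-α / 2) (-α / 2) (1 : ℝ) (‖z‖ ^ 2 : ℝ) := by
  have hfF : f =ᶠ[nhds z] alphaPoisson α fun φ => fstar (Circle.exp φ) := by
    filter_upwards [Metric.isOpen_ball.mem_nhds hz] with w hw
    exact hf.eq_alphaPoisson hα fstar.continuous hbd hw
  have h1 : normD f z = normD (alphaPoisson α fun φ => fstar (Circle.exp φ)) z := by
    simp only [normD, wirtingerZ, wirtingerZBar, hfF.fderiv_eq]
  rw [h1]
  exact normD_alphaPoisson_le hα (fstar.continuous.comp Circle.exp.continuous)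
    (fun φ => fstar.norm_coe_le_norm _) hz

theorem mainTheorem1 (α : ℝ) (hα : -1 < α) (f : ℂ → ℂ) (hf : IsAlphaHarmonic α f)
    (fstar : C(Circle, ℂ)) (hbd : HasDistributionalBoundaryValue f fstar) :
    (0 ≤ α → ∀ z ∈ Metric.ball (0 : ℂ) 1,
      normD f z ≤ 2 * (1 + α) * ‖fstar‖ / (1 - ‖z‖ ^ 2) *
        ordinaryHypergeometric (-α / 2) (-α / 2) (1 : ℝ) (‖z‖ ^ 2 : ℝ)) ∧
    (α < 0 → ∀ z ∈ Metric.ball (0 : ℂ) 1,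
      normD f z ≤ 2 * ‖fstar‖ / (1 - ‖z‖ ^ 2) *
        ordinaryHypergeometric (-α / 2) (-α / 2) (1 : ℝ) (‖z‖ ^ 2 : ℝ)) := by
  constructor
  · intro h z hz
    have := hf.normD_le hα fstar hbd hz
    rwa [abs_of_nonneg h, show 2 + α + α = 2 * (1 + α) by ring] at this
  · intro h z hz
    have := hf.normD_le hα fstar hbd hz
    rwa [abs_of_neg h, show 2 + α + -α = 2 by ring] at this
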